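/- **Setting.** Let $\mathbf k$ be a field of characteristic zero. Let $\mathrm{Tame}(\mathbf k^m)$ be the group of polynomial automorphisms of $\mathbf k^m$ generated by the affine automorphisms and the maps $(x_1,\dots,x_m)\mapsto(x_1+P(x_2,\dots,x_m),x_2,\dots,x_m)$. For $1\le r\le m$, an $r$-tuple of components is a polynomial map $(f_1,\dots,f_r)\colon\mathbf k^m\to\mathbf k^r$ that extends to a tame automorphism $(f_1,\dots,f_m)$, and $[f_1,\dots,f_r]$ denotes its orbit under post-composition by the affine group of $\mathbf k^r$. Let $\mathcal C_m$ be the simplicial complex whose vertices of type $r$ are these orbits, and whose maximal simplices are spanned by $[f_1],[f_1,f_2],\dots,[f_1,\dots,f_m]$ for $(f_1,\dots,f_m)\in\mathrm{Tame}(\mathbf k^m)$; $\mathrm{Tame}(\mathbf k^m)$ acts by $g\cdot[f_1,\dots,f_r]=[f_1\circ g^{-1},\dots,f_r\circ g^{-1}]$. Put $\mathcal C=\mathcal C_3$; $\mathcal C_2$ is a tree. **Axis.** For an integer $n\ge 0$ let $g^{-1}=(x_2,x_1+x_2x_3,x_3)$, $h^{-1}=(x_3,x_1,x_2)$, $f=g^n\circ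 h$. Let $\gamma$ be the edge path in $\mathcal C$ with $\gamma(2j)=f^j\cdot[x_1]$ and $\gamma(2j+1)=f^j\cdot[x_1,x_3]$ for $j\in\mathbb Z$. **Diagrams.** A disc diagram in $\mathcal C$ is a combinatorial (not necessarily simplicial) complex $\mathcal D$ built of finitely many triangles and homeomorphic to a closed disc, with a combinatorial map $\mathcal D\to\mathcal C$; vertices of $\mathcal D$ have the type of their image. It is reduced if the map is a local embedding at the interior points of edges and at the interior vertices of type $1$. **Arrows.** Let $e$ be an interior edge of type $(1,2)$ of a reduced disc diagram, and let $T,T'$ be the images of its two adjacent triangles. The edge $e$ is oriented if some element of $\mathrm{Tame}(\mathbf k^3)$ sends $T,T'$ to the triangles with vertices $$[x_3],\ [x_2,x_3],\ [x_1,x_2,x_3]\quad\text{and}\quad [x_3],\ [x_2,x_3],\ [x_1+P(x_2,x_3),x_2,x_3],$$ where $P=A(q)$ for some $A\in\mathbf k[X]$ and some component $q\in\mathbf k[x_2,x_3]$ of a tame automorphism in the variables $x_2,x_3$. Then $P=c(ax_2+bx_3)^d+(\text{terms of degree}<d)$ with $d\ge2$, $c\ne0$, $(a,b)\neq(0,0)$,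 and $e$ carries an arrow pointing towards the connected component containing $[ax_2+bx_3]$ of the tree $\mathcal C_2$ (in the variables $x_2,x_3$) with the open edge between $[x_3]$ and $[x_2,x_3]$ removed. Boundary edges carry no arrows. For a boundary vertex $v$ of type $1$ let $\deg v$ be its valence in $\mathcal D$, and let $\mathrm{out}\,v$ and $\mathrm{in}\,v$ be the numbers of edges at $v$ with an arrow pointing away from $v$, respectively towards $v$. The boundary curvature of $v$ is $$K_\partial(v)=\frac{7-\deg v}{12}+\frac{\mathrm{out}\,v-\mathrm{in}\,v}{6}.$$ **Proposition.** Let $n\ge0$ and let $\mathcal D\to\mathcal C$ be a reduced disc diagram that agrees with $\gamma[1,3]$ on a subpath of $\partial\mathcal D$. Then the boundary curvature at the vertex of this subpath mapped to $\gamma(2)$ satisfies $K_\partial\le\frac{2-n}{6}$. -/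

import Mathlib

open MvPolynomial

noncomputable section

/-! ### Tame automorphisms

A polynomial automorphism `g` of `𝔸ⁿ` is represented by the `k`-algebra automorphism
`P ↦ P ∘ g⁻¹` of `k[x_1, …, x_n]`.  This is a group isomorphism, `g ∘ h` corresponding to
the product `g * h`.  The variable `x_{i+1}` is `X i`. -/

/-- The polynomial automorphisms of affine `n`-space. -/
abbrev PolyAut (k : Type*) [Field k] (n : ℕ) : Type _ :=
  MvPolynomial (Fin n) k ≃ₐ[k] MvPolynomial (Fin n) k

/-- The action of an affine map `y ↦ A y + b` of `k^r` on `r`-tuples of polynomials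
by post-composition. -/
def affineComp {k : Type*} [Field k] {n r : ℕ} (A : GL (Fin r) k) (b : Fin r → k)
    (f : Fin r → MvPolynomial (Fin n) k) : Fin r → MvPolynomial (Fin n) k :=
  fun i => ∑ j, C ((A : Matrix (Fin r) (Fin r) k) i j) * f j + C (b i)

/-- `φ` is affine. -/
def IsAffineAut {k : Type*} [Field k] {n : ℕ} (φ : PolyAut k n) : Prop :=
  ∃ (A : GL (Fin n) k) (b : Fin n → k), ∀ i, φ (X i) = affineComp A b X i

/-- `φ` is elementary: `(x_1, …, x_n) ↦ (x_1 + P(x_2, …, x_n), x_2, …, x_n)`. -/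
def IsElementaryAut {k : Type*} [Field k] {n : ℕ} [NeZero n] (φ : PolyAut k n) : Prop :=
  ∃ P ∈ supported k {i : Fin n | i ≠ 0},
    φ (X 0) = X 0 + P ∧ ∀ i : Fin n, i ≠ 0 → φ (X i) = X i

/-- The tame automorphism group. -/
def Tame (k : Type*) [Field k] (n : ℕ) [NeZero n] : Subgroup (PolyAut k n) :=
  Subgroup.closure {φ | IsAffineAut φ ∨ IsElementaryAut φ}

/-! ### The complex `C_n` -/

/-- `f = (f_1, …, f_r)` is an `r`-tuple of components, i.e. the first `r` coordinates of a
tame automorphism. -/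
def IsComponents {k : Type*} [Field k] {n : ℕ} [NeZero n] {r : ℕ}
    (f : Fin r → MvPolynomial (Fin n) k) : Prop :=
  ∃ hr : r ≤ n, ∃ φ ∈ Tame k n, ∀ i : Fin r, φ (X (Fin.castLE hr i)) = f i

/-- The orbit `[f_1, …, f_r]` of `f` under the affine group `A_r`. -/
def orbitClass {k : Type*} [Field k] {n r : ℕ} (f : Fin r → MvPolynomial (Fin n) k) :
    Set (Fin r → MvPolynomial (Fin n) k) :=
  {g | ∃ (A : GL (Fin r) k) (b : Fin r → k), g = affineComp A b f}

/-- The vertices of type `r` of the complex `C_n`. -/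
def Vertex (k : Type*) [Field k] (n : ℕ) [NeZero n] (r : ℕ) : Type _ :=
  {S : Set (Fin r → MvPolynomial (Fin n) k) // ∃ f, IsComponents f ∧ S = orbitClass f}

/-- All vertices of `C_n`.  The index `r : Fin n` stands for type `r + 1`. -/
abbrev Vert (k : Type*) [Field k] (n : ℕ) [NeZero n] : Type _ :=
  Σ r : Fin n, Vertex k n (r + 1)

/-- The vertices `v 0, …, v (n-1)` of types `1, …, n` span a maximal simplex of `C_n`: they are
`[f_1], [f_1, f_2], …, [f_1, …, f_n]` for some tame automorphism `(f_1, …, f_n)`. -/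
def IsMaxSimplex {k : Type*} [Field k] {n : ℕ} [NeZero n]
    (v : ∀ r : Fin n, Vertex k n (r + 1)) : Prop :=
  ∃ f : Fin n → MvPolynomial (Fin n) k, IsComponents f ∧
    ∀ r : Fin n, (v r).1 = orbitClass (fun j : Fin (r + 1) => f (Fin.castLE r.2 j))

/-- The `1`-skeleton of `C_n`. -/
def skeleton (k : Type*) [Field k] (n : ℕ) [NeZero n] : SimpleGraph (Vert k n) where
  Adj a b := a.1 ≠ b.1 ∧
    ∃ v : ∀ r : Fin n, Vertex k n (r + 1), IsMaxSimplex v ∧ v a.1 = a.2 ∧ v b.1 = b.2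
  symm := ⟨fun _ _ ⟨h, v, hv, h1, h2⟩ => ⟨h.symm, v, hv, h2, h1⟩⟩
  loopless := ⟨fun _ h => h.1 rfl⟩

/-- The vertex `[f_1, …, f_r]`. -/
def mkVertex {k : Type*} [Field k] {n : ℕ} [NeZero n] {r : ℕ}
    (f : Fin r → MvPolynomial (Fin n) k) (hf : IsComponents f) : Vertex k n r :=
  ⟨orbitClass f, f, hf, rfl⟩

lemma map_affineComp {k : Type*} [Field k] {n r : ℕ} (φ : PolyAut k n) (A : GL (Fin r) k)
    (b : Fin r → k) (f : Fin r → MvPolynomial (Fin n) k) :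
    (fun i => φ (affineComp A b f i)) = affineComp A b (fun i => φ (f i)) := by
  funext i
  have hC : ∀ c : k, φ (C c) = C c := fun c => φ.commutes c
  simp [affineComp, hC]

/-- The action of tame automorphisms on vertices:
`g · [f_1, …, f_r] = [f_1 ∘ g⁻¹, …, f_r ∘ g⁻¹]`. -/
def Vertex.act {k : Type*} [Field k] {n : ℕ} [NeZero n] {r : ℕ} (g : Tame k n)
    (v : Vertex k n r) : Vertex k n r :=
  ⟨(fun f i => (g : PolyAut k n) (f i)) '' v.1, by
    obtain ⟨S, f, ⟨hr, φ, hφ, hf⟩, rfl⟩ := v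
    refine ⟨fun i => (g : PolyAut k n) (f i), ⟨hr, g * φ, mul_mem g.2 hφ, fun i => ?_⟩, ?_⟩
    · rw [AlgEquiv.mul_apply, hf]
    · ext p
      constructor
      · rintro ⟨_, ⟨A, b, rfl⟩, rfl⟩
        exact ⟨A, b, map_affineComp _ A b f⟩
      · rintro ⟨A, b, rfl⟩
        exact ⟨_, ⟨A, b, rfl⟩, map_affineComp _ A b f⟩⟩

/-! ### The automorphism `f = gⁿ ∘ h` and its axis -/

/-- The automorphism `g`, with `g⁻¹ = (x_2, x_1 + x_2 x_3, x_3)`. -/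
def gAut (k : Type*) [Field k] : PolyAut k 3 :=
  AlgEquiv.ofAlgHom (aeval ![X 1, X 0 + X 1 * X 2, X 2]) (aeval ![X 1 - X 0 * X 2, X 0, X 2])
    (by ext i : 1; fin_cases i <;> simp) (by ext i : 1; fin_cases i <;> simp)

/-- The automorphism `h`, with `h⁻¹ = (x_3, x_1, x_2)`. -/
def hAut (k : Type*) [Field k] : PolyAut k 3 :=
  AlgEquiv.ofAlgHom (aeval ![X 2, X 0, X 1]) (aeval ![X 1, X 2, X 0])
    (by ext i : 1; fin_cases i <;> simp) (by ext i : 1; fin_cases i <;> simp)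

lemma hAut_mem (k : Type*) [Field k] : hAut k ∈ Tame k 3 := by
  refine Subgroup.subset_closure (Or.inl ⟨Matrix.GeneralLinearGroup.mkOfDetNeZero
    !![0, 0, 1; 1, 0, 0; 0, 1, 0] (by simp [Matrix.det_fin_three]), 0, fun i => ?_⟩)
  fin_cases i <;>
    simp [hAut, affineComp, Fin.sum_univ_three, Matrix.GeneralLinearGroup.mkOfDetNeZero]

/-- The transposition of `x_1` and `x_2`. -/
def swapAut (k : Type*) [Field k] : PolyAut k 3 :=
  AlgEquiv.ofAlgHom (aeval ![X 1, X 0, X 2]) (aeval ![X 1, X 0, X 2])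
    (by ext i : 1; fin_cases i <;> simp) (by ext i : 1; fin_cases i <;> simp)

lemma swapAut_mem (k : Type*) [Field k] : swapAut k ∈ Tame k 3 := by
  refine Subgroup.subset_closure (Or.inl ⟨Matrix.GeneralLinearGroup.mkOfDetNeZero
    !![0, 1, 0; 1, 0, 0; 0, 0, 1] (by simp [Matrix.det_fin_three]), 0, fun i => ?_⟩)
  fin_cases i <;>
    simp [swapAut, affineComp, Fin.sum_univ_three, Matrix.GeneralLinearGroup.mkOfDetNeZero]

lemma gAut_mem (k : Type*) [Field k] : gAut k ∈ Tame k 3 := by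
  have h : gAut k * swapAut k ∈ Tame k 3 := by
    refine Subgroup.subset_closure (Or.inr ⟨X 1 * X 2, ?_, ?_, fun i hi => ?_⟩)
    · exact mul_mem (X_mem_supported.2 (by simp)) (X_mem_supported.2 (by simp))
    · simp [gAut, swapAut, AlgEquiv.mul_apply]
    · fin_cases i <;> simp_all [gAut, swapAut, AlgEquiv.mul_apply]
  exact (Subgroup.mul_mem_cancel_right _ (swapAut_mem k)).1 h

/-- The automorphism `f = gⁿ ∘ h`. -/
def fAut (k : Type*) [Field k] (n : ℕ) : Tame k 3 :=
  (⟨gAut k, gAut_mem k⟩ : Tame k 3) ^ n * ⟨hAut k, hAut_mem k⟩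

lemma isComponents_x1 (k : Type*) [Field k] :
    IsComponents (![X 0] : Fin 1 → MvPolynomial (Fin 3) k) :=
  ⟨by norm_num, 1, one_mem _, fun i => by fin_cases i; rfl⟩

lemma isComponents_x1_x3 (k : Type*) [Field k] :
    IsComponents (![X 0, X 2] : Fin 2 → MvPolynomial (Fin 3) k) := by
  refine ⟨by norm_num, hAut k * swapAut k, mul_mem (hAut_mem k) (swapAut_mem k), fun i => ?_⟩
  fin_cases i
  · simp [swapAut, hAut, AlgEquiv.mul_apply]
  · have h : (Fin.castLE (by norm_num : 2 ≤ 3) 1 : Fin 3) = 1 := rfl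
    simp [swapAut, hAut, AlgEquiv.mul_apply, h]

/-- The vertices `γ(m)`, `m ∈ ℤ`, of the candidate axis `γ` of `f`:
`γ(2j) = f^j · [x_1]` and `γ(2j + 1) = f^j · [x_1, x_3]`. -/
def axis (k : Type*) [Field k] (n : ℕ) (m : ℤ) : Vert k 3 :=
  if Even m then ⟨0, (mkVertex ![X 0] (isComponents_x1 k)).act (fAut k n ^ (m / 2))⟩
  else ⟨1, (mkVertex ![X 0, X 2] (isComponents_x1_x3 k)).act (fAut k n ^ (m / 2))⟩

/-! ### Arrows -/

/-- The type `1` vertex of the tree `C_2` (in the variables `y_1 = X 0`, `y_2 = X 1`) towards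
which an edge carrying `P(y_1, y_2)` is oriented: `P = A(q)` for a component `q` and
`P = c ℓ^d + ` lower order terms, where `ℓ = a y_1 + b y_2`, and the vertex is `[ℓ]`. -/
def IsDirection {k : Type*} [Field k] (P : MvPolynomial (Fin 2) k) (u : Vertex k 2 1) : Prop :=
  (∃ (q : MvPolynomial (Fin 2) k) (A : Polynomial k),
      IsComponents ![q] ∧ P = Polynomial.aeval q A) ∧
    ∃ (a b c : k) (d : ℕ), 2 ≤ d ∧ c ≠ 0 ∧
      u.1 = orbitClass ![C a * X 0 + C b * X 1] ∧
      (P - C c * (C a * X 0 + C b * X 1) ^ d).totalDegree < d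

/-- The two triangles `v_1, v_2, v_3` and `v_1, v_2, v_3'` with the common edge `v_1 v_2` are,
after the action of the tame automorphism `φ`, in the position
`[x_3], [x_2, x_3], [x_1, x_2, x_3]` and
`[x_3], [x_2, x_3], [x_1 + P(x_2, x_3), x_2, x_3]`. -/
def IsNormalForm {k : Type*} [Field k] (φ : PolyAut k 3) (P : MvPolynomial (Fin 2) k)
    (v1 : Vertex k 3 1) (v2 : Vertex k 3 2) (v3 v3' : Vertex k 3 3) : Prop :=
  v1.1 = orbitClass ![φ (X 2)] ∧
  v2.1 = orbitClass ![φ (X 1), φ (X 2)] ∧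
  v3.1 = orbitClass ![φ (X 0), φ (X 1), φ (X 2)] ∧
  v3'.1 = orbitClass ![φ (X 0 + aeval ![X 1, X 2] P), φ (X 1), φ (X 2)]

/-- The common edge `e` of the triangles `v_1, v_2, v_3` and `v_1, v_2, v_3'` carries an arrow
pointing towards its end of type `i + 1` (`i = 0` or `i = 1`).  In normal form, `e` is the edge
of the tree `C_2` in the variables `(y_1, y_2) = (x_2, x_3)` from `[y_2]` to `[y_1, y_2]`, and
the arrow points towards the connected component of `C_2 - e` containing the direction `[ℓ]`. -/
def ArrowTowards {k : Type*} [Field k] (i : Fin 2)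
    (v1 : Vertex k 3 1) (v2 : Vertex k 3 2) (v3 v3' : Vertex k 3 3) : Prop :=
  ∃ φ ∈ Tame k 3, ∃ P : MvPolynomial (Fin 2) k, IsNormalForm φ P v1 v2 v3 v3' ∧
    ∃ (u : Vertex k 2 1) (e : ∀ j : Fin 2, Vertex k 2 (j + 1)),
      IsDirection P u ∧
      (e 0).1 = orbitClass ![X 1] ∧ (e 1).1 = orbitClass ![X 0, X 1] ∧
      ((skeleton k 2).deleteEdges {s(⟨0, e 0⟩, ⟨1, e 1⟩)}).Reachable ⟨0, u⟩ ⟨i, e i⟩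

/-! ### Disc diagrams

Since the vertices of a triangle of `C = C_3` have the three types `1, 2, 3`, every triangle of a
diagram in `C` has exactly one corner of each type, and it can only be glued to another triangle
along sides with the same types.  So the underlying complex is given by its finite set of
triangles and three involutions: `σ i t` is the triangle adjacent to `t` along the side of `t`
opposite to the corner of type `i + 1`, and `σ i t = t` when that side is a free (boundary)
side. -/

/-- The gluing of the points of the triangles along their common sides. -/
def GlueRel {F : Type} (σ : Fin 3 → F → F) (a b : Σ _ : F, stdSimplex ℝ (Fin 3)) : Prop :=
  ∃ i : Fin 3, b.1 = σ i a.1 ∧ b.2 = a.2 ∧ (a.2 : Fin 3 → ℝ) i = 0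

/-- The topological space obtained by gluing the triangles, with the quotient topology. -/
abbrev GluedSpace {F : Type} (σ : Fin 3 → F → F) : Type := Quot (GlueRel σ)

/-- A disc diagram in `C = C_3`: a complex of triangles homeomorphic to a disc, with a
combinatorial map to `C`.  The map is given by the images `vert i t` of the corners (of type
`i + 1`) of the triangles `t`. -/
structure DiscDiagram (k : Type*) [Field k] where
  Face : Type
  [finite_face : Finite Face]
  σ : Fin 3 → Face → Face
  involutive : ∀ i, Function.Involutive (σ i)
  homeo_disc : Nonempty (GluedSpace σ ≃ₜ Metric.closedBall (0 : EuclideanSpace ℝ (Fin 2)) 1)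
  vert : ∀ i : Fin 3, Face → Vertex k 3 (i + 1)
  vert_glue : ∀ i j t, j ≠ i → vert i (σ j t) = vert i t
  isTriangle : ∀ t, IsMaxSimplex fun i => vert i t

namespace DiscDiagram

/-- The image in `C` of the corner of `t` of type `i + 1`. -/
def image {k : Type*} [Field k] (D : DiscDiagram k) (i : Fin 3) (t : D.Face) : Vert k 3 :=
  ⟨i, D.vert i t⟩

/-- The triangles around the corner of `t` of type `i + 1`.  A vertex of `D` of type `i + 1`
is represented by any triangle containing it. -/
def star {k : Type*} [Field k] (D : DiscDiagram k) (i : Fin 3) (t : D.Face) : Set D.Face :=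
  {s | Relation.ReflTransGen (fun a b => ∃ j, j ≠ i ∧ b = D.σ j a) t s}

/-- The edge of `D` which is the side of `t` opposite to the corner of type `j + 1`, given as
the set of triangles containing it. -/
def edge {k : Type*} [Field k] (D : DiscDiagram k) (j : Fin 3) (t : D.Face) : Set D.Face :=
  {t, D.σ j t}

/-- The side of `t` opposite to the corner of type `j + 1` lies on the boundary of `D`. -/
def IsBoundaryEdge {k : Type*} [Field k] (D : DiscDiagram k) (j : Fin 3) (t : D.Face) : Prop :=
  D.σ j t = t

/-- The corner of `t` of type `i + 1` is an interior vertex of `D`. -/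
def IsInteriorVertex {k : Type*} [Field k] (D : DiscDiagram k) (i : Fin 3) (t : D.Face) :
    Prop :=
  ∀ s ∈ D.star i t, ∀ j, j ≠ i → ¬ D.IsBoundaryEdge j s

/-- `D` is reduced: the map `D → C` is a local embedding at the interior points of edges (the two
triangles at an interior edge have distinct images) and at the interior vertices of type `1`
(distinct edges of type `(1,2)`, edges of type `(1,3)`, and triangles at the vertex have
distinct images). -/
structure IsReduced {k : Type*} [Field k] (D : DiscDiagram k) : Prop where
  edges : ∀ j t, ¬ D.IsBoundaryEdge j t → D.vert j (D.σ j t) ≠ D.vert j t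
  vertices : ∀ t, D.IsInteriorVertex 0 t → ∀ s ∈ D.star 0 t, ∀ s' ∈ D.star 0 t,
    (D.vert 1 s = D.vert 1 s' → D.edge 2 s = D.edge 2 s') ∧
    (D.vert 2 s = D.vert 2 s' → D.edge 1 s = D.edge 1 s') ∧
    (D.vert 1 s = D.vert 1 s' → D.vert 2 s = D.vert 2 s' → s = s')

/-- The valence in `D` of the corner of `t` of type `i + 1`. -/
def valence {k : Type*} [Field k] (D : DiscDiagram k) (i : Fin 3) (t : D.Face) : ℕ :=
  ∑ j ∈ Finset.univ.erase i, (D.edge j '' D.star i t).ncard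

/-- The number of edges of type `(1,2)` at the type `1` corner of `t` carrying an arrow which
points towards the end of type `i + 1` of the edge.  Boundary edges carry no arrows. -/
def arrows {k : Type*} [Field k] (D : DiscDiagram k) (i : Fin 2) (t : D.Face) : ℕ :=
  (D.edge 2 '' {s ∈ D.star 0 t | ¬ D.IsBoundaryEdge 2 s ∧
    ArrowTowards i (D.vert 0 s) (D.vert 1 s) (D.vert 2 s) (D.vert 2 (D.σ 2 s))}).ncard

/-- The boundary curvature `(7 - deg v) / 12 + (out v - in v) / 6` at the type `1` corner `v`
of `t`. -/
def boundaryCurvature {k : Type*} [Field k] (D : DiscDiagram k) (t : D.Face) : ℚ :=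
  (7 - (D.valence 0 t : ℚ)) / 12 + ((D.arrows 1 t : ℚ) - (D.arrows 0 t : ℚ)) / 6

end DiscDiagram

end

/-! Let `v` be the boundary vertex over `γ(2) = [x_3]`. The triangles at `v` form a strip of `2m`
triangles, so `deg v ≥ 2m + 1` (`le_valence`), and the curvature is at most `(3 - m + out v) / 6`.
It remains to see that at least `n` of the `m - 1` interior edges of type `(1,2)` at `v` carry no
arrow pointing away from `v`.

The type `2` vertices along the strip are `[p_j, x_3]` with `p_0 = x_1` and `p_m = g^{n+1} · x_1`.
Consecutive ones form automorphisms `(p_j, p_{j+1}, x_3)`, so `p_{j+2} = α_j p_j + P_j(p_{j+1},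
x_3)` (`CoordPair.eq_elementary`). Call the turn at `p_{j+1}` linear if `P_j(Y, z)` has degree at
most `1` in `Y`.

An outward arrow forces a nonlinear turn (`one_lt_natDegree_of_arrowTowards`): its direction `[a x_2
+ b x_3]` cannot be `[x_3]`, so `a ≠ 0` and the polynomial has degree `d ≥ 2` in `x_2`. This rests
on an edge of `C_2` separating its two ends, proved with leading forms and the Jacobian
(`not_reachable_of_onSide`).

There are at least `n` linear turns (`le_card_linear_turns`). Cancelling backtracks never increases
their number (`PathBound.step`). Along a reduced path a lexicographic degree strictly increases, so
its last step is determined by its end (`RedPath.eq_smul_add_of_coordPair`). A reduced path to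
`g^{n+1} · x_1` therefore runs through all the `g^i · x_1`, and there every turn is linear because
`g^{i+2} · x_1 = g^i · x_1 + x_3 (g^{i+1} · x_1)`. -/

/-! ### Evaluation of polynomials in `q` and `x_3` -/

section Substitution

variable {k : Type*} [Field k]

/-- The value `P(q, x_3)` of `P ∈ k[z][Y]`. -/
noncomputable def subst (q : MvPolynomial (Fin 3) k) :
    Polynomial (Polynomial k) →+* MvPolynomial (Fin 3) k :=
  Polynomial.eval₂RingHom
    (Polynomial.aeval (X 2 : MvPolynomial (Fin 3) k) : Polynomial k →ₐ[k] _).toRingHom q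

@[simp] lemma subst_X (q : MvPolynomial (Fin 3) k) : subst q Polynomial.X = q := by
  simp [subst]

lemma subst_C (q : MvPolynomial (Fin 3) k) (ρ : Polynomial k) :
    subst q (Polynomial.C ρ) = Polynomial.aeval (X 2) ρ := by
  simp [subst]

@[simp] lemma subst_C_C (q : MvPolynomial (Fin 3) k) (a : k) :
    subst q (Polynomial.C (Polynomial.C a)) = C a := by
  simp [subst, MvPolynomial.algebraMap_eq]

@[simp] lemma subst_C_X (q : MvPolynomial (Fin 3) k) :
    subst q (Polynomial.C Polynomial.X) = X 2 := by
  simp [subst]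

lemma map_subst (φ : MvPolynomial (Fin 3) k →ₐ[k] MvPolynomial (Fin 3) k) (h : φ (X 2) = X 2)
    (q : MvPolynomial (Fin 3) k) (P : Polynomial (Polynomial k)) :
    φ (subst q P) = subst (φ q) P := by
  have : (φ.toRingHom.comp (subst q)) = subst (φ q) := by
    refine Polynomial.ringHom_ext' ?_ (by simp)
    refine Polynomial.ringHom_ext' ?_ (by simp [h])
    ext a
    simp [MvPolynomial.algHom_C, MvPolynomial.algebraMap_eq]
  exact congrArg (fun f : Polynomial (Polynomial k) →+* _ => f P) this

/-- The specialization `(x_1, x_2, x_3) ↦ (0, Y, z)`. -/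
noncomputable def spec : MvPolynomial (Fin 3) k →ₐ[k] Polynomial (Polynomial k) :=
  aeval ![0, Polynomial.X, Polynomial.C Polynomial.X]

@[simp] lemma spec_X0 : spec (X 0 : MvPolynomial (Fin 3) k) = 0 := by simp [spec]
@[simp] lemma spec_X1 : spec (X 1 : MvPolynomial (Fin 3) k) = Polynomial.X := by simp [spec]
@[simp] lemma spec_X2 : spec (X 2 : MvPolynomial (Fin 3) k) = Polynomial.C Polynomial.X := by
  simp [spec]
@[simp] lemma spec_C (a : k) :
    spec (C a : MvPolynomial (Fin 3) k) = Polynomial.C (Polynomial.C a) := by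
  rw [MvPolynomial.algHom_C]; rfl

lemma spec_subst (q : MvPolynomial (Fin 3) k) (P : Polynomial (Polynomial k)) :
    spec (subst q P) = P.comp (spec q) := by
  have : ((spec (k := k)).toRingHom.comp (subst q)) = Polynomial.compRingHom (spec q) := by
    refine Polynomial.ringHom_ext' ?_ (by simp)
    refine Polynomial.ringHom_ext' ?_ (by simp)
    ext a : 1
    simp
  exact congrArg (fun f : Polynomial (Polynomial k) →+* _ => f P) this

/-! ### Coordinate pairs over `k[x_3]` -/

/-- `(p, q, x_3)` is an automorphism. -/
def CoordPair (p q : MvPolynomial (Fin 3) k) : Prop :=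
  ∃ φ : PolyAut k 3, φ (X 0) = p ∧ φ (X 1) = q ∧ φ (X 2) = X 2

/-- An algebra automorphism of `k[x_1, x_2, x_3]` from mutually inverse substitutions. -/
lemma exists_polyAut (f g : Fin 3 → MvPolynomial (Fin 3) k) (h1 : ∀ i, aeval f (g i) = X i)
    (h2 : ∀ i, aeval g (f i) = X i) : ∃ φ : PolyAut k 3, ∀ i, φ (X i) = f i :=
  ⟨AlgEquiv.ofAlgHom (aeval f) (aeval g) (by ext i : 1; simpa using h1 i)
    (by ext i : 1; simpa using h2 i), fun i => by simp⟩

lemma CoordPair.symm {p q : MvPolynomial (Fin 3) k} (h : CoordPair p q) : CoordPair q p := by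
  obtain ⟨φ, h0, h1, h2⟩ := h
  exact ⟨φ * swapAut k, by simp [AlgEquiv.mul_apply, swapAut, h1],
    by simp [AlgEquiv.mul_apply, swapAut, h0], by simp [AlgEquiv.mul_apply, swapAut, h2]⟩

lemma CoordPair.elementary {p q : MvPolynomial (Fin 3) k} (h : CoordPair p q) {α : k}
    (hα : α ≠ 0) (P : Polynomial (Polynomial k)) : CoordPair (C α * p + subst q P) q := by
  obtain ⟨φ, h0, h1, h2⟩ := h
  have key : ∀ x : MvPolynomial (Fin 3) k,
      aeval ![x, X 1, X 2] (subst (X 1) P) = subst (X 1) P := fun x => by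
    rw [map_subst _ (by simp)]; simp
  have e1 : C α * C α⁻¹ = (1 : MvPolynomial (Fin 3) k) := by
    rw [← C_mul, mul_inv_cancel₀ hα, C_1]
  have hC : ∀ (f : Fin 3 → MvPolynomial (Fin 3) k) a, aeval f (C a : MvPolynomial (Fin 3) k)
      = C a := fun f a => by rw [algHom_C]; rfl
  obtain ⟨θ, hθ⟩ := exists_polyAut (k := k) ![C α * X 0 + subst (X 1) P, X 1, X 2]
    ![C α⁻¹ * (X 0 - subst (X 1) P), X 1, X 2]
    (by
      intro i; fin_cases i
      · simp only [Fin.zero_eta, Matrix.cons_val_zero, map_mul, map_sub, hC, aeval_X]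
        rw [key]; linear_combination X 0 * e1
      · simp
      · simp)
    (by
      intro i; fin_cases i
      · simp only [Fin.zero_eta, Matrix.cons_val_zero, map_mul, map_add, hC, aeval_X]
        rw [key]; linear_combination (X 0 - subst (X 1) P) * e1
      · simp
      · simp)
  refine ⟨φ * θ, ?_, ?_, ?_⟩
  · have := map_subst (φ : MvPolynomial (Fin 3) k →ₐ[k] MvPolynomial (Fin 3) k) h2 (X 1) P
    have hc : φ (C α) = C α := φ.commutes α
    simp only [AlgEquiv.coe_toAlgHom, h1] at this
    simp [AlgEquiv.mul_apply, hθ, this, h0, hc]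
  · simp [AlgEquiv.mul_apply, hθ, h1]
  · simp [AlgEquiv.mul_apply, hθ, h2]

lemma exists_subst_eq_rename (v : MvPolynomial (Fin 2) k) :
    subst (X 1) (aeval ![Polynomial.X, Polynomial.C Polynomial.X] v) = rename Fin.succ v := by
  induction v using MvPolynomial.induction_on with
  | C a =>
    rw [algHom_C, rename_C]
    exact subst_C_C _ a
  | add p q hp hq => simp [hp, hq]
  | mul_X p i hp => fin_cases i <;> simp [hp]

lemma finSuccEquiv_C_apply (a : k) : finSuccEquiv k 2 (C a) = Polynomial.C (C a) := by
  simp [finSuccEquiv_apply]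

lemma finSuccEquiv_rename_succ (v : MvPolynomial (Fin 2) k) :
    finSuccEquiv k 2 (rename Fin.succ v) = Polynomial.C v := by
  induction v using MvPolynomial.induction_on with
  | C a => rw [rename_C, finSuccEquiv_C_apply]
  | add p q hp hq => simp [hp, hq]
  | mul_X p i hp => simp [hp, finSuccEquiv_X_succ]

/-- In `k[X 1, X 2][X 0]`, an automorphism fixing `X 1` and `X 2` is the substitution of the image
of `X 0`, so composing automorphisms becomes composing one-variable polynomials. -/
lemma finSuccEquiv_conj_eq_comp (χ : PolyAut k 3) (h1 : χ (X 1) = X 1) (h2 : χ (X 2) = X 2)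
    (g : Polynomial (MvPolynomial (Fin 2) k)) :
    finSuccEquiv k 2 (χ ((finSuccEquiv k 2).symm g)) = g.comp (finSuccEquiv k 2 (χ (X 0))) := by
  have h : ((finSuccEquiv k 2).toRingEquiv.toRingHom.comp (χ.toRingEquiv.toRingHom.comp
      (finSuccEquiv k 2).symm.toRingEquiv.toRingHom))
      = Polynomial.compRingHom (finSuccEquiv k 2 (χ (X 0))) := by
    refine Polynomial.ringHom_ext' (MvPolynomial.ringHom_ext (fun a => ?_) (fun i => ?_)) ?_
    · have : (finSuccEquiv k 2).symm (Polynomial.C (C a)) = C a := by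
        rw [AlgEquiv.symm_apply_eq]; simp [finSuccEquiv_apply]
      have hc : χ (C a) = C a := χ.commutes a
      simp [this, hc, finSuccEquiv_apply]
    · have : (finSuccEquiv k 2).symm (Polynomial.C (X i)) = X i.succ := by
        rw [AlgEquiv.symm_apply_eq]; simp [finSuccEquiv_X_succ]
      have hc : χ (X i.succ) = X i.succ := by fin_cases i <;> assumption
      simp [this, hc, finSuccEquiv_X_succ]
    · have : (finSuccEquiv k 2).symm Polynomial.X = X 0 := by
        rw [AlgEquiv.symm_apply_eq]; simp [finSuccEquiv_X_zero]
      simp [this]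
  exact congrArg (fun f : Polynomial (MvPolynomial (Fin 2) k) →+* _ => f g) h

/-- Degrees multiply under composition, so the image of `X 0` has degree `1` in `X 0`; its leading
coefficient is a unit of a polynomial ring over a field, hence a nonzero constant. -/
lemma polyAut_fixing_X1_X2 (ψ : PolyAut k 3) (h1 : ψ (X 1) = X 1) (h2 : ψ (X 2) = X 2) :
    ∃ α : k, α ≠ 0 ∧ ∃ P, ψ (X 0) = C α * X 0 + subst (X 1) P := by
  have hX : (finSuccEquiv k 2 (ψ.symm (X 0))).comp (finSuccEquiv k 2 (ψ (X 0)))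
      = Polynomial.X := by
    rw [← finSuccEquiv_conj_eq_comp ψ h1 h2, AlgEquiv.symm_apply_apply,
      AlgEquiv.apply_symm_apply, finSuccEquiv_X_zero]
  generalize finSuccEquiv k 2 (ψ.symm (X 0)) = g at hX
  generalize hf : finSuccEquiv k 2 (ψ (X 0)) = f at hX
  have hd := congrArg Polynomial.natDegree hX
  rw [Polynomial.natDegree_comp, Polynomial.natDegree_X] at hd
  have hfd : f.natDegree = 1 := Nat.eq_one_of_mul_eq_one_left hd
  have hl := congrArg Polynomial.leadingCoeff hX
  rw [Polynomial.leadingCoeff_comp (by omega), Polynomial.leadingCoeff_X,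
    Nat.eq_one_of_mul_eq_one_right hd, pow_one] at hl
  obtain ⟨α, hα, hu⟩ :=
    MvPolynomial.isUnit_iff_eq_C_of_isReduced.1 (IsUnit.of_mul_eq_one_right _ hl)
  refine ⟨α, hα.ne_zero, aeval ![Polynomial.X, Polynomial.C Polynomial.X] (f.coeff 0), ?_⟩
  have hE : f = Polynomial.C f.leadingCoeff * Polynomial.X + Polynomial.C (f.coeff 0) := by
    rw [Polynomial.leadingCoeff, hfd]
    exact Polynomial.eq_X_add_C_of_natDegree_le_one hfd.le
  rw [hu] at hE
  rw [exists_subst_eq_rename, ← (finSuccEquiv k 2).injective.eq_iff, hf, map_add, map_mul,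
    finSuccEquiv_X_zero, finSuccEquiv_rename_succ, finSuccEquiv_C_apply]
  exact hE

lemma CoordPair.eq_elementary {p p' q : MvPolynomial (Fin 3) k} (h : CoordPair p q)
    (h' : CoordPair p' q) : ∃ α : k, α ≠ 0 ∧ ∃ P, p' = C α * p + subst q P := by
  obtain ⟨φ, h0, h1, h2⟩ := h
  obtain ⟨φ', h0', h1', h2'⟩ := h'
  obtain ⟨α, hα, P, hP⟩ := polyAut_fixing_X1_X2 (φ⁻¹ * φ')
    (by rw [AlgEquiv.mul_apply, h1', ← h1]; exact φ.symm_apply_apply _)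
    (by rw [AlgEquiv.mul_apply, h2', ← h2]; simpa [h2] using φ.symm_apply_apply (X 2))
  refine ⟨α, hα, P, ?_⟩
  have hc : φ (C α) = C α := φ.commutes α
  have h3 := congrArg φ hP
  have := map_subst (φ : MvPolynomial (Fin 3) k →ₐ[k] MvPolynomial (Fin 3) k) h2 (X 1) P
  simp only [AlgEquiv.coe_toAlgHom, h1] at this
  rw [AlgEquiv.mul_apply, map_add, map_mul, hc, h0, this, h0'] at h3
  rw [← h3]
  exact (φ.apply_symm_apply p').symm

end Substitution

/-! ### Reduced paths in the link of `[x_3]` -/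

section ReducedPath

/-- A polynomial `P` of degree at least `1`, other than `P = β Y + ρ` with `β` a constant. -/
def IsBending {k : Type*} [Field k] (P : Polynomial (Polynomial k)) : Prop :=
  1 < P.natDegree ∨ 0 < (P.coeff 1).natDegree

/-- The lexicographic degree of a polynomial in `Y` and `z`. -/
noncomputable def lexDegree {k : Type*} [Field k] (P : Polynomial (Polynomial k)) : ℕ ×ₗ ℕ :=
  toLex (P.natDegree, P.leadingCoeff.natDegree)

variable {k : Type*} [Field k]

/-! ### Bending polynomials and the lexicographic degree. -/

lemma exists_eq_of_not_isBending {P : Polynomial (Polynomial k)} (h : ¬ IsBending P) :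
    P.natDegree ≤ 1 ∧ ∃ (β : k) (ρ : Polynomial k),
      P = Polynomial.C (Polynomial.C β) * Polynomial.X + Polynomial.C ρ := by
  simp only [IsBending, not_or, not_lt, nonpos_iff_eq_zero] at h
  refine ⟨h.1, (P.coeff 1).coeff 0, P.coeff 0, ?_⟩
  rw [← Polynomial.eq_C_of_natDegree_eq_zero h.2]
  exact Polynomial.eq_X_add_C_of_natDegree_le_one h.1

lemma lexDegree_lt_iff {P Q : Polynomial (Polynomial k)} : lexDegree P < lexDegree Q ↔
    P.natDegree < Q.natDegree ∨
      P.natDegree = Q.natDegree ∧ P.leadingCoeff.natDegree < Q.leadingCoeff.natDegree := by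
  simp [lexDegree, Prod.Lex.toLex_lt_toLex]

lemma lexDegree_eq_iff {P Q : Polynomial (Polynomial k)} : lexDegree P = lexDegree Q ↔
    P.natDegree = Q.natDegree ∧ P.leadingCoeff.natDegree = Q.leadingCoeff.natDegree := by
  simp [lexDegree]

/-- When the degrees in `Y` agree, the leading coefficients cannot cancel because their degrees in
`z` differ. -/
lemma lexDegree_add_eq_right {P Q : Polynomial (Polynomial k)} (h : lexDegree P < lexDegree Q) :
    lexDegree (P + Q) = lexDegree Q := by
  rw [lexDegree_lt_iff] at h
  rw [lexDegree_eq_iff]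
  rcases h with h | ⟨h1, h2⟩
  · exact ⟨Polynomial.natDegree_add_eq_right_of_natDegree_lt h, by
      rw [Polynomial.leadingCoeff_add_of_degree_lt (Polynomial.degree_lt_degree h)]⟩
  · have hc : (P + Q).coeff Q.natDegree = P.leadingCoeff + Q.leadingCoeff := by
      rw [Polynomial.coeff_add, Polynomial.leadingCoeff, h1, Polynomial.leadingCoeff]
    have hd := Polynomial.natDegree_add_eq_right_of_natDegree_lt h2
    have hn : (P + Q).natDegree = Q.natDegree := by
      refine le_antisymm (Polynomial.natDegree_add_le_of_degree_le h1.le le_rfl)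
        (Polynomial.le_natDegree_of_ne_zero ?_)
      rw [hc]
      intro h0
      rw [h0] at hd
      simp at hd
      omega
    exact ⟨hn, by rw [Polynomial.leadingCoeff, hn, hc, hd]⟩

lemma lexDegree_C_C_mul {P : Polynomial (Polynomial k)} {α : k} (hα : α ≠ 0) :
    lexDegree (Polynomial.C (Polynomial.C α) * P) = lexDegree P := by
  rw [lexDegree_eq_iff, Polynomial.leadingCoeff_mul, Polynomial.leadingCoeff_C,
    Polynomial.natDegree_C_mul (by simpa using hα), Polynomial.natDegree_C_mul hα]
  exact ⟨rfl, rfl⟩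

/-- A bending `P` either multiplies the degree in `Y` by at least `2`, or has degree `1` and
multiplies the leading coefficient by a nonconstant polynomial in `z`. -/
lemma lexDegree_lt_comp {P Q : Polynomial (Polynomial k)} (hP : IsBending P)
    (hQ : 0 < Q.natDegree) : lexDegree Q < lexDegree (P.comp Q) := by
  have hQ0 : Q ≠ 0 := by rintro rfl; simp at hQ
  rw [lexDegree_lt_iff, Polynomial.natDegree_comp, Polynomial.leadingCoeff_comp hQ.ne']
  rcases hP with hP | hP
  · left; nlinarith
  · have h1 : 1 ≤ P.natDegree := by
      refine Polynomial.le_natDegree_of_ne_zero ?_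
      intro h; rw [h] at hP; simp at hP
    rcases h1.lt_or_eq with h1 | h1
    · left; nlinarith
    · right
      have hl : P.leadingCoeff = P.coeff 1 := by rw [Polynomial.leadingCoeff, ← h1]
      rw [hl, ← h1, one_mul, pow_one, Polynomial.natDegree_mul]
      · exact ⟨rfl, by omega⟩
      · intro h; rw [h] at hP; simp at hP
      · simpa using hQ0

lemma lexDegree_C_lt {Q : Polynomial (Polynomial k)} (hQ : 0 < Q.natDegree) (ρ : Polynomial k) :
    lexDegree (Polynomial.C ρ) < lexDegree Q := by
  rw [lexDegree_lt_iff]; left; simpa using hQ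

/-! ### Reduced paths. -/

/-- A reduced path in the link of `[x_3]` issuing from `[x_1, x_3]` and ending with
`[r, x_3], [q, x_3]`, up to translations by polynomials in `x_3`; `c` counts the turns that are
linear over `k[x_3]`. -/
inductive RedPath {k : Type*} [Field k] :
    ℕ → MvPolynomial (Fin 3) k → MvPolynomial (Fin 3) k → Prop
  | base {q} : CoordPair (X 0) q → RedPath 0 (X 0) q
  | linear {c r₀ r} {α : k} {P} : RedPath c r₀ r → α ≠ 0 → IsBending P → P.natDegree ≤ 1 →
      RedPath (c + 1) r (C α * r₀ + subst r P)
  | nonlinear {c r₀ r} {α : k} {P} : RedPath c r₀ r → α ≠ 0 → IsBending P → 1 < P.natDegree →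
      RedPath c r (C α * r₀ + subst r P)

lemma RedPath.step {c : ℕ} {r₀ r : MvPolynomial (Fin 3) k} {α : k}
    {P : Polynomial (Polynomial k)} (h : RedPath c r₀ r) (hα : α ≠ 0) (hP : IsBending P) :
    RedPath (c + if P.natDegree ≤ 1 then 1 else 0) r (C α * r₀ + subst r P) := by
  split_ifs with h1
  · exact h.linear hα hP h1
  · exact h.nonlinear hα hP (by omega)

lemma RedPath.coordPair {c : ℕ} {r q : MvPolynomial (Fin 3) k} (h : RedPath c r q) :
    CoordPair r q := by
  induction h with
  | base h => exact h
  | linear _ hα _ _ ih => exact (ih.elementary hα _).symm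
  | nonlinear _ hα _ _ ih => exact (ih.elementary hα _).symm

lemma IsBending.smul_add {P : Polynomial (Polynomial k)} (hP : IsBending P) {β : k} (hβ : β ≠ 0)
    (γ : k) (ρ : Polynomial k) :
    IsBending (Polynomial.C (Polynomial.C β) * P + (Polynomial.C (Polynomial.C γ) * Polynomial.X
      + Polynomial.C ρ)) := by
  have hl : (Polynomial.C (Polynomial.C γ) * Polynomial.X
      + Polynomial.C ρ).natDegree ≤ 1 := Polynomial.natDegree_linear_le
  rcases hP with hP | hP
  · left
    rw [Polynomial.natDegree_add_eq_left_of_natDegree_lt] <;>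
      rw [Polynomial.natDegree_C_mul (by simpa using hβ)] <;> omega
  · right
    have : (Polynomial.C (Polynomial.C β) * P + (Polynomial.C (Polynomial.C γ) * Polynomial.X
      + Polynomial.C ρ)).coeff 1 = Polynomial.C β * P.coeff 1 + Polynomial.C γ := by
      simp [Polynomial.coeff_C]
    rwa [this, Polynomial.natDegree_add_C, Polynomial.natDegree_C_mul hβ]

lemma natDegree_smul_add_le_one_iff {P : Polynomial (Polynomial k)} {β : k} (hβ : β ≠ 0)
    (γ : k) (ρ : Polynomial k) :
    (Polynomial.C (Polynomial.C β) * P + (Polynomial.C (Polynomial.C γ) * Polynomial.X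
      + Polynomial.C ρ)).natDegree ≤ 1 ↔ P.natDegree ≤ 1 := by
  have hl : (Polynomial.C (Polynomial.C γ) * Polynomial.X
      + Polynomial.C ρ).natDegree ≤ 1 := Polynomial.natDegree_linear_le
  have hm : (Polynomial.C (Polynomial.C β) * P).natDegree = P.natDegree :=
    Polynomial.natDegree_C_mul (by simpa using hβ)
  constructor
  · intro h
    by_contra h1
    rw [Polynomial.natDegree_add_eq_left_of_natDegree_lt (by omega)] at h
    omega
  · intro h
    exact Polynomial.natDegree_add_le_of_degree_le (by omega) hl


lemma subst_smul_add (q : MvPolynomial (Fin 3) k) (P : Polynomial (Polynomial k)) (β γ : k)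
    (ρ : Polynomial k) :
    subst q (Polynomial.C (Polynomial.C β) * P + (Polynomial.C (Polynomial.C γ) * Polynomial.X
      + Polynomial.C ρ)) = C β * subst q P + (C γ * q + Polynomial.aeval (X 2) ρ) := by
  simp [subst_C]

/-- The end may be moved within the type `3` vertex `[r, q, x_3]`, up to translation: the last
polynomial `P` becomes `β P + γ Y + ρ`, which changes neither bending nor linearity. -/
lemma RedPath.congr {c : ℕ} {r q : MvPolynomial (Fin 3) k} (h : RedPath c r q) {β : k}
    (hβ : β ≠ 0) (γ : k) (ρ : Polynomial k) :
    RedPath c r (C β * q + (C γ * r + Polynomial.aeval (X 2) ρ)) := by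
  have e : ∀ {α : k} {r₀} {P : Polynomial (Polynomial k)},
      C β * (C α * r₀ + subst r P) + (C γ * r + Polynomial.aeval (X 2) ρ) =
        C (β * α) * r₀ + subst r (Polynomial.C (Polynomial.C β) * P +
          (Polynomial.C (Polynomial.C γ) * Polynomial.X + Polynomial.C ρ)) := by
    intro α r₀ P
    rw [subst_smul_add, C_mul]; ring
  cases h with
  | base h =>
    refine .base ?_
    have := (h.symm.elementary hβ
      (Polynomial.C (Polynomial.C γ) * Polynomial.X + Polynomial.C ρ)).symm
    simpa [subst_C] using this
  | linear h hα hP h1 =>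
    rw [e]
    exact h.linear (mul_ne_zero hβ hα) (hP.smul_add hβ γ ρ)
      ((natDegree_smul_add_le_one_iff hβ γ ρ).2 h1)
  | nonlinear h hα hP h1 =>
    rw [e]
    refine h.nonlinear (mul_ne_zero hβ hα) (hP.smul_add hβ γ ρ) ?_
    have := (natDegree_smul_add_le_one_iff (P := _) hβ γ ρ).not.2 h1.not_ge
    omega

/-! ### Reducing an arbitrary path. -/

/-- A path in the link of `[x_3]` with `N` linear turns and last vertices `[p, x_3], [q, x_3]`
can be compared with a reduced path to `[q, x_3]`: either that path has fewer linear turns, or it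
has at most `N` and ends in the same type `3` vertex. -/
def PathBound {k : Type*} [Field k] (N : ℕ) (p q : MvPolynomial (Fin 3) k) : Prop :=
  (∃ (α : k) (ρ : Polynomial k), α ≠ 0 ∧ q = C α * X 0 + Polynomial.aeval (X 2) ρ) ∨
  ∃ c r, RedPath c r q ∧ (c + 1 ≤ N ∨ c ≤ N ∧ ∃ (α β : k) (ρ : Polynomial k), α ≠ 0 ∧
    p = C α * r + (C β * q + Polynomial.aeval (X 2) ρ))

lemma C_inv_mul {α : k} (hα : α ≠ 0) : C α⁻¹ * C α = (1 : MvPolynomial (Fin 3) k) := by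
  rw [← C_mul, inv_mul_cancel₀ hα, C_1]

lemma CoordPair.smul_add {p q : MvPolynomial (Fin 3) k} (h : CoordPair p q) {α : k}
    (hα : α ≠ 0) (ρ : Polynomial k) :
    CoordPair (C α * p + Polynomial.aeval (X 2) ρ) q := by
  simpa [subst_C] using h.elementary hα (Polynomial.C ρ)

/-- The given path reaches `q` from `p`, the reduced one from `r`. Expressed through `r`, the next
vertex has a new polynomial `P'`. If `P'` bends, the reduced path is extended; otherwise the next
vertex is a backtrack to `r` (`β = 0`) or moves the end within `[r, q, x_3]` (`β ≠ 0`). If `p` and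
`r` give the same type `3` vertex up to translation, `P` and `P'` are linear together; if not, `P'`
may be linear while `P` is not, and the spare unit in `c + 1 ≤ N` pays for it. -/
lemma PathBound.step_of_redPath {N c : ℕ} {p q r : MvPolynomial (Fin 3) k} {α : k} (hα : α ≠ 0)
    {P : Polynomial (Polynomial k)} (hpq : CoordPair p q) (h : RedPath c r q)
    (hN : c + 1 ≤ N ∨ c ≤ N ∧ ∃ (α β : k) (ρ : Polynomial k), α ≠ 0 ∧
      p = C α * r + (C β * q + Polynomial.aeval (X 2) ρ)) :
    PathBound (N + if P.natDegree ≤ 1 then 1 else 0) q (C α * p + subst q P) := by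
  have hex : ∃ (α' : k) (P' : Polynomial (Polynomial k)), α' ≠ 0 ∧
      C α * p + subst q P = C α' * r + subst q P' ∧
      (c + 1 ≤ N ∨ c ≤ N ∧ (P'.natDegree ≤ 1 ↔ P.natDegree ≤ 1)) := by
    rcases hN with hN | ⟨hN, γ, β, ρ, hγ, rfl⟩
    · obtain ⟨α', hα', P', hP'⟩ := h.coordPair.eq_elementary (hpq.elementary hα P)
      exact ⟨α', P', hα', hP', Or.inl hN⟩
    · refine ⟨α * γ, Polynomial.C (Polynomial.C 1) * P + (Polynomial.C (Polynomial.C (α * β)) *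
        Polynomial.X + Polynomial.C (Polynomial.C α * ρ)), mul_ne_zero hα hγ, ?_, Or.inr ⟨hN, ?_⟩⟩
      · rw [subst_smul_add]
        simp [algebraMap_eq]; ring
      · exact natDegree_smul_add_le_one_iff one_ne_zero _ _
  obtain ⟨α', P', hα', hE, hN⟩ := hex
  rw [hE]
  by_cases hb : IsBending P'
  · refine Or.inr ⟨_, _, h.step hα' hb, ?_⟩
    right
    refine ⟨?_, 1, 0, 0, one_ne_zero, by simp⟩
    split_ifs <;> grind
  obtain ⟨h1, β, ρ, rfl⟩ := exists_eq_of_not_isBending hb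
  -- A non-bending `P'` has degree at most `1`, so without a spare unit the turn `P` is itself
  -- linear and counted.
  have hN' : c + 1 ≤ N + if P.natDegree ≤ 1 then 1 else 0 := by
    split_ifs <;> grind
  by_cases hβ : β = 0
  · subst hβ
    have e : C α' * r + (subst q) (Polynomial.C (Polynomial.C 0) * Polynomial.X + Polynomial.C ρ)
        = C α' * r + Polynomial.aeval (X 2) ρ := by simp [subst_C]
    rw [e]
    cases h with
    -- Backtracking along the only edge returns to `[x_1, x_3]` up to translation. A `RedPath` has
    -- at least one edge, whence the separate first alternative of `PathBound`.
    | base h => exact Or.inl ⟨α', ρ, hα', rfl⟩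
    | linear h hα₀ hP h1 =>
      refine Or.inr ⟨_, _, by simpa using h.congr hα' 0 ρ, Or.inl (by omega)⟩
    | nonlinear h hα₀ hP h1 =>
      refine Or.inr ⟨_, _, by simpa using h.congr hα' 0 ρ, Or.inl (by omega)⟩
  · have e : C α' * r + (subst q) (Polynomial.C (Polynomial.C β) * Polynomial.X + Polynomial.C ρ)
        = C β * q + (C α' * r + Polynomial.aeval (X 2) ρ) := by simp [subst_C]; ring
    rw [e]
    refine Or.inr ⟨c, r, h.congr hβ α' ρ, Or.inr ⟨by omega, -β⁻¹ * α', β⁻¹,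
      Polynomial.C (-β⁻¹) * ρ, by simp [hβ, hα'], ?_⟩⟩
    have := C_inv_mul hβ
    simp only [map_mul, map_neg, Polynomial.aeval_C, algebraMap_eq]
    linear_combination (-q) * this

lemma PathBound.step {N : ℕ} {p q : MvPolynomial (Fin 3) k} {α : k} (hα : α ≠ 0)
    {P : Polynomial (Polynomial k)} (hpq : CoordPair p q) (h : PathBound N p q) :
    PathBound (N + if P.natDegree ≤ 1 then 1 else 0) q (C α * p + subst q P) := by
  rcases h with ⟨β, ρ, hβ, rfl⟩ | ⟨c, r, h, hN⟩
  -- The path is back at its origin, so the next edge starts a new reduced path without turns.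
  · refine Or.inr ⟨0, X 0, .base ?_, Or.inr ⟨Nat.zero_le _, β, 0, ρ, hβ, by simp⟩⟩
    have := (hpq.elementary hα P).symm.smul_add (inv_ne_zero hβ) (Polynomial.C (-β⁻¹) * ρ)
    have e := C_inv_mul hβ
    convert this using 1
    simp only [map_mul, Polynomial.aeval_C, algebraMap_eq, C_neg]
    linear_combination (-X 0) * e
  · exact step_of_redPath hα hpq h hN

lemma CoordPair.pathBound {q : MvPolynomial (Fin 3) k} (h : CoordPair (X 0) q) :
    PathBound 0 (X 0) q :=
  Or.inr ⟨0, X 0, .base h, Or.inr ⟨le_rfl, 1, 0, 0, one_ne_zero, by simp⟩⟩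

/-! ### The axis -/

/-- The components `g^i · x_1`. -/
noncomputable def axisComponent (k : Type*) [Field k] (i : ℕ) : MvPolynomial (Fin 3) k :=
  (gAut k ^ i) (X 0)

@[simp] lemma gAut_X0 : gAut k (X 0) = X 1 := by simp [gAut]
@[simp] lemma gAut_X1 : gAut k (X 1) = X 0 + X 1 * X 2 := by simp [gAut]
@[simp] lemma gAut_X2 : gAut k (X 2) = X 2 := by simp [gAut]

lemma gAut_pow_X2 (i : ℕ) : (gAut k ^ i) (X 2) = X 2 := by
  induction i with
  | zero => simp
  | succ i ih => rw [pow_succ, AlgEquiv.mul_apply, gAut_X2, ih]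

lemma gAut_pow_X1 (i : ℕ) : (gAut k ^ i) (X 1) = axisComponent k (i + 1) := by
  rw [axisComponent, pow_succ, AlgEquiv.mul_apply, gAut_X0]

lemma axisComponent_succ_succ (i : ℕ) : axisComponent k (i + 2) =
    axisComponent k i + axisComponent k (i + 1) * X 2 := by
  rw [← gAut_pow_X1, pow_succ, AlgEquiv.mul_apply, gAut_X1, map_add, map_mul, gAut_pow_X1,
    gAut_pow_X2, ← axisComponent]

lemma coordPair_axisComponent (i : ℕ) :
    CoordPair (axisComponent k i) (axisComponent k (i + 1)) :=
  ⟨gAut k ^ i, rfl, gAut_pow_X1 i, gAut_pow_X2 i⟩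

lemma spec_axisComponent_zero : spec (axisComponent k 0) = 0 := by
  simp [axisComponent]

/-- Each step of the recurrence keeps degree `1` in `Y` and raises the degree in `z` of the leading
coefficient by one. The strict inequality makes the induction work; it starts at the zero
polynomial, whose `lexDegree` is `(0, 0)` by convention. -/
lemma spec_axisComponent (i : ℕ) : lexDegree (spec (axisComponent k (i + 1))) = toLex (1, i) ∧
    lexDegree (spec (axisComponent k i)) < lexDegree (spec (axisComponent k (i + 1))) := by
  induction i with
  | zero =>
    have : spec (axisComponent k 1) = Polynomial.X := by simp [axisComponent]
    rw [zero_add, this, spec_axisComponent_zero]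
    simp [lexDegree, Prod.Lex.toLex_lt_toLex]
  | succ i ih =>
    obtain ⟨h1, h2⟩ := ih
    set s := spec (axisComponent k (i + 1))
    have hd : s.natDegree = 1 ∧ s.leadingCoeff.natDegree = i := by
      simpa [lexDegree] using h1
    have hl : s.leadingCoeff ≠ 0 := by
      intro h
      rw [Polynomial.leadingCoeff_eq_zero] at h
      simp [h] at hd
    have h3 : lexDegree (s * Polynomial.C Polynomial.X) = toLex (1, i + 1) := by
      rw [lexDegree, Polynomial.leadingCoeff_mul, Polynomial.leadingCoeff_C,
        Polynomial.natDegree_mul_C Polynomial.X_ne_zero, Polynomial.natDegree_mul_X hl, hd.1, hd.2]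
    have h4 : lexDegree s < lexDegree (s * Polynomial.C Polynomial.X) := by
      rw [h1, h3, Prod.Lex.toLex_lt_toLex]; right; simp
    rw [axisComponent_succ_succ, map_add, map_mul, spec_X2, lexDegree_add_eq_right (h2.trans h4)]
    exact ⟨h3, h4⟩

/-! ### Degree growth along reduced paths. -/

lemma spec_aeval_X2 (ρ : Polynomial k) :
    spec (Polynomial.aeval (X 2 : MvPolynomial (Fin 3) k) ρ) = Polynomial.C ρ := by
  rw [← subst_C (X 1), spec_subst]; simp

lemma natDegree_pos_of_lexDegree_lt {P Q : Polynomial (Polynomial k)} (hP : 0 < P.natDegree)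
    (h : lexDegree P < lexDegree Q) : 0 < Q.natDegree := by
  rw [lexDegree_lt_iff] at h; omega

lemma lexDegree_lt_smul_add_comp {P Q R : Polynomial (Polynomial k)} (hP : IsBending P)
    (hQ : 0 < Q.natDegree) (h : lexDegree R < lexDegree Q) {α : k} (hα : α ≠ 0) :
    lexDegree (Polynomial.C (Polynomial.C α) * R + P.comp Q) = lexDegree (P.comp Q) ∧
      lexDegree Q < lexDegree (Polynomial.C (Polynomial.C α) * R + P.comp Q) := by
  have h1 := lexDegree_lt_comp hP hQ
  have h2 : lexDegree (Polynomial.C (Polynomial.C α) * R + P.comp Q) = lexDegree (P.comp Q) :=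
    lexDegree_add_eq_right (by rw [lexDegree_C_C_mul hα]; exact h.trans h1)
  exact ⟨h2, h2 ▸ h1⟩

/-- Every bend raises the degree. The specialization `x_1 ↦ 0` is needed for the first edge: there
`q = α x_2 + P(x_1, x_3)` with `P` of arbitrary degree, of which only `P(0, z)` survives. -/
lemma RedPath.lexDegree_lt {c : ℕ} {r q : MvPolynomial (Fin 3) k} (h : RedPath c r q) :
    0 < (spec q).natDegree ∧ lexDegree (spec r) < lexDegree (spec q) := by
  induction h with
  | base h =>
    obtain ⟨α, hα, P, rfl⟩ := CoordPair.eq_elementary (p := X 1)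
      (⟨swapAut k, by simp [swapAut], by simp [swapAut], by simp [swapAut]⟩) h.symm
    have : 0 < (spec (C α * X 1 + subst (X 0) P)).natDegree := by
      rw [map_add, map_mul, spec_subst, spec_C, spec_X0, spec_X1, Polynomial.comp_zero,
        Polynomial.natDegree_linear (by simpa using hα)]
      exact one_pos
    refine ⟨this, ?_⟩
    simpa using lexDegree_C_lt this 0
  | linear _ hα hP _ ih =>
    rw [map_add, map_mul, spec_subst, spec_C]
    have := (lexDegree_lt_smul_add_comp hP ih.1 ih.2 hα).2
    exact ⟨natDegree_pos_of_lexDegree_lt ih.1 this, this⟩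
  | nonlinear _ hα hP _ ih =>
    rw [map_add, map_mul, spec_subst, spec_C]
    have := (lexDegree_lt_smul_add_comp hP ih.1 ih.2 hα).2
    exact ⟨natDegree_pos_of_lexDegree_lt ih.1 this, this⟩

lemma lexDegree_spec_smul_add {s : MvPolynomial (Fin 3) k} {α : k} (hα : α ≠ 0)
    (ρ : Polynomial k) (hs : 0 < (spec s).natDegree) :
    lexDegree (spec (C α * s + Polynomial.aeval (X 2) ρ)) = lexDegree (spec s) := by
  have h : lexDegree (Polynomial.C (Polynomial.C α) * spec s) = lexDegree (spec s) :=
    lexDegree_C_C_mul hα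
  rw [map_add, map_mul, spec_C, spec_aeval_X2, add_comm, lexDegree_add_eq_right, h]
  rw [h]
  exact lexDegree_C_lt hs ρ

/-- Up to scaling and translation, `q` has only one partner of smaller degree. In `r = α s + P(q,
x_3)`, a bending `P` would make the degree of `r` exceed that of `q`, and a term `β q` with `β ≠ 0`
would make them equal. -/
lemma RedPath.eq_smul_add_of_coordPair {c : ℕ} {r q s : MvPolynomial (Fin 3) k}
    (h : RedPath c r q) (hs : CoordPair s q) (hlt : lexDegree (spec s) < lexDegree (spec q)) :
    ∃ (α : k) (ρ : Polynomial k), α ≠ 0 ∧ r = C α * s + Polynomial.aeval (X 2) ρ := by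
  obtain ⟨α, hα, P, rfl⟩ := hs.eq_elementary h.coordPair
  obtain ⟨h0, hr⟩ := h.lexDegree_lt
  rw [map_add, map_mul, spec_C, spec_subst] at hr
  by_cases hP : IsBending P
  · exact absurd hr (lexDegree_lt_smul_add_comp hP h0 hlt hα).2.not_gt
  obtain ⟨-, β, ρ, rfl⟩ := exists_eq_of_not_isBending hP
  by_cases hβ : β = 0
  · exact ⟨α, ρ, hα, by simp [hβ, subst_C]⟩
  · have h1 : lexDegree (Polynomial.C (Polynomial.C β) * spec q + Polynomial.C ρ) =
        lexDegree (spec q) := by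
      rw [add_comm, lexDegree_add_eq_right, lexDegree_C_C_mul hβ]
      rw [lexDegree_C_C_mul hβ]; exact lexDegree_C_lt h0 ρ
    simp only [Polynomial.add_comp, Polynomial.mul_comp, Polynomial.C_comp,
      Polynomial.X_comp] at hr
    rw [lexDegree_add_eq_right, h1] at hr
    · exact absurd hr (lt_irrefl _)
    · rwa [h1, lexDegree_C_C_mul hα]

/-- Going backwards, the predecessor of `g^{i+1} · x_1` is forced to be `g^i · x_1`. Both have
degree `1` in `Y` for `i ≥ 1`, whereas a nonlinear turn would multiply this degree by at least `2`;
so each step back uses up one linear turn. -/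
lemma RedPath.le_of_axisComponent {n c : ℕ} {r q : MvPolynomial (Fin 3) k} (h : RedPath c r q)
    {α : k} (hα : α ≠ 0) {ρ : Polynomial k}
    (hq : q = C α * axisComponent k (n + 1) + Polynomial.aeval (X 2) ρ) : n ≤ c := by
  induction n generalizing c r q α ρ with
  | zero => exact Nat.zero_le _
  | succ n ih =>
    have hpos : ∀ i, 0 < (spec (axisComponent k (i + 1))).natDegree := fun i => by
      have := congrArg (fun x => (ofLex x).1) (spec_axisComponent (k := k) i).1
      simp only [lexDegree, ofLex_toLex] at this
      omega
    have hlq : lexDegree (spec q) = toLex (1, n + 1) := by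
      rw [hq, lexDegree_spec_smul_add hα ρ (hpos _), (spec_axisComponent _).1]
    obtain ⟨β, σ, hβ, hr⟩ := h.eq_smul_add_of_coordPair (s := axisComponent k (n + 1))
      (by rw [hq]; exact ((coordPair_axisComponent _).symm.smul_add hα ρ).symm)
      (by rw [hlq, (spec_axisComponent _).1, Prod.Lex.toLex_lt_toLex]; right; simp)
    have hlr : lexDegree (spec r) = toLex (1, n) := by
      rw [hr, lexDegree_spec_smul_add hβ σ (hpos _), (spec_axisComponent _).1]
    have hdr : (spec r).natDegree = 1 := by
      have := congrArg (fun x => (ofLex x).1) hlr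
      simpa only [lexDegree, ofLex_toLex] using this
    cases h with
    | base h => simp at hdr
    | linear h => exact Nat.succ_le_succ (ih h hβ hr)
    | nonlinear h hα' hP h1 =>
      obtain ⟨h2, h3⟩ := h.lexDegree_lt
      rw [map_add, map_mul, spec_C, spec_subst,
        (lexDegree_lt_smul_add_comp hP h2 h3 hα').1] at hlq
      have := congrArg (fun x => (ofLex x).1) hlq
      simp only [lexDegree, ofLex_toLex, Polynomial.natDegree_comp, hdr] at this
      omega

lemma PathBound.le_of_axisComponent {n N : ℕ} {p : MvPolynomial (Fin 3) k}
    (h : PathBound N p (axisComponent k (n + 1))) : n ≤ N := by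
  rcases h with ⟨α, ρ, hα, h⟩ | ⟨c, r, h, hN⟩
  · have h1 := (spec_axisComponent (k := k) n).1
    rw [h, map_add, map_mul, spec_X0, mul_zero, zero_add, spec_aeval_X2] at h1
    simp [lexDegree] at h1
  · have := h.le_of_axisComponent (n := n) one_ne_zero (ρ := 0) (by simp)
    omega

/-- A path in the link of `[x_3]` from `[x_1, x_3]` to `[g^{n+1} · x_1, x_3]` has at least `n`
turns that are linear over `k[x_3]`. -/
theorem le_card_linear_turns {n m : ℕ} (p : ℕ → MvPolynomial (Fin 3) k) (α : ℕ → k)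
    (P : ℕ → Polynomial (Polynomial k)) (h0 : p 0 = X 0) (hm : 1 ≤ m)
    (hp : ∀ j < m, CoordPair (p j) (p (j + 1))) (hα : ∀ j, α j ≠ 0)
    (hturn : ∀ j, j + 1 < m → p (j + 2) = C (α j) * p j + subst (p (j + 1)) (P j))
    (hend : p m = axisComponent k (n + 1)) :
    n ≤ ((Finset.range (m - 1)).filter fun j => (P j).natDegree ≤ 1).card := by
  -- Once the edge from `p j` to `p (j + 1)` is traversed, the turns made are those of index less
  -- than `j`.
  have key : ∀ j < m, PathBound ((Finset.range j).filter fun j => (P j).natDegree ≤ 1).card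
      (p j) (p (j + 1)) := by
    intro j
    induction j with
    | zero =>
      intro hj
      have := hp 0 hj
      rw [h0] at this ⊢
      simpa using this.pathBound
    | succ j ih =>
      intro hj
      have := (ih (by omega)).step (hα j) (P := P j) (hp j (by omega))
      rw [← hturn j hj] at this
      rw [Finset.range_add_one, Finset.filter_insert]
      split_ifs at this ⊢ with h
      · rwa [Finset.card_insert_of_notMem (by simp)]
      · exact this
  have := key (m - 1) (by omega)
  rw [Nat.sub_add_cancel hm, hend] at this
  exact this.le_of_axisComponent

end ReducedPath

/-! ### Affine orbits -/

section AffineOrbit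

variable {k : Type*} [Field k] {n r : ℕ}

lemma affineComp_affineComp (A B : GL (Fin r) k) (b c : Fin r → k)
    (f : Fin r → MvPolynomial (Fin n) k) : affineComp A b (affineComp B c f) =
      affineComp (A * B) (fun i => ∑ j, (A : Matrix (Fin r) (Fin r) k) i j * c j + b i) f := by
  funext i
  simp only [affineComp, mul_add, Finset.sum_add_distrib, Matrix.GeneralLinearGroup.coe_mul,
    Matrix.mul_apply, map_sum, map_mul, map_add, Finset.sum_mul, Finset.mul_sum]
  rw [Finset.sum_comm]
  simp only [mul_assoc, add_assoc]

lemma affineComp_one_zero (f : Fin r → MvPolynomial (Fin n) k) : affineComp 1 0 f = f := by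
  funext i
  simp [affineComp, Matrix.one_apply]

lemma affineComp_inv (A : GL (Fin r) k) (b : Fin r → k) :
    ∃ c : Fin r → k, ∀ f : Fin r → MvPolynomial (Fin n) k,
      affineComp A⁻¹ c (affineComp A b f) = f ∧ affineComp A b (affineComp A⁻¹ c f) = f := by
  refine ⟨fun i => -∑ j, ((A⁻¹ : GL (Fin r) k) : Matrix (Fin r) (Fin r) k) i j * b j,
    fun f => ⟨?_, ?_⟩⟩
  · rw [affineComp_affineComp, inv_mul_cancel]
    convert affineComp_one_zero f using 2
    funext i; simp
  · rw [affineComp_affineComp, mul_inv_cancel]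
    convert affineComp_one_zero f using 2
    funext i
    have h : ∀ i l, ∑ j, (A : Matrix (Fin r) (Fin r) k) i j *
        ((A⁻¹ : GL (Fin r) k) : Matrix (Fin r) (Fin r) k) j l = (1 : Matrix _ _ k) i l := by
      intro i l
      rw [← Matrix.mul_apply, ← Matrix.GeneralLinearGroup.coe_mul, mul_inv_cancel]; rfl
    simp only [mul_neg, Finset.sum_neg_distrib, Finset.mul_sum]
    rw [Finset.sum_comm]
    simp only [← mul_assoc, ← Finset.sum_mul, h]
    simp [Matrix.one_apply]

lemma mem_orbitClass_self (f : Fin r → MvPolynomial (Fin n) k) : f ∈ orbitClass f :=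
  ⟨1, 0, (affineComp_one_zero f).symm⟩

lemma orbitClass_eq_of_mem {f g : Fin r → MvPolynomial (Fin n) k} (h : g ∈ orbitClass f) :
    orbitClass g = orbitClass f := by
  obtain ⟨A, b, rfl⟩ := h
  obtain ⟨c, hc⟩ := affineComp_inv (n := n) A b
  ext x
  constructor
  · rintro ⟨B, d, rfl⟩
    exact ⟨_, _, affineComp_affineComp _ _ _ _ _⟩
  · rintro ⟨B, d, rfl⟩
    exact ⟨_, _, by rw [← affineComp_affineComp B A⁻¹ d c, (hc f).1]⟩

lemma mem_of_orbitClass_eq {f g : Fin r → MvPolynomial (Fin n) k}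
    (h : orbitClass g = orbitClass f) : g ∈ orbitClass f :=
  h ▸ mem_orbitClass_self g

lemma exists_affine_polyAut (A : GL (Fin n) k) (b : Fin n → k) :
    ∃ φ : PolyAut k n, ∀ i, φ (X i) = affineComp A b X i := by
  obtain ⟨c, hc⟩ := affineComp_inv (n := n) A b
  have key : ∀ (B : GL (Fin n) k) (d : Fin n → k) (f : Fin n → MvPolynomial (Fin n) k) (i),
      aeval f (affineComp B d X i) = affineComp B d f i := by
    intro B d f i
    have hC : ∀ a : k, aeval f (C a : MvPolynomial (Fin n) k) = C a := fun a => by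
      rw [algHom_C]; rfl
    simp [affineComp]
  refine ⟨AlgEquiv.ofAlgHom (aeval (affineComp A b X)) (aeval (affineComp A⁻¹ c X)) ?_ ?_,
    fun i => by simp⟩
  · ext i : 1
    simp only [AlgHom.comp_apply, aeval_X, key, (hc X).1, AlgHom.id_apply]
  · ext i : 1
    simp only [AlgHom.comp_apply, aeval_X, key, (hc X).2, AlgHom.id_apply]

lemma mem_orbitClass_one {f g : Fin 1 → MvPolynomial (Fin n) k} :
    g ∈ orbitClass f ↔ ∃ a b : k, a ≠ 0 ∧ g 0 = C a * f 0 + C b := by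
  constructor
  · rintro ⟨A, b, rfl⟩
    refine ⟨A.1 0 0, b 0, ?_, by simp [affineComp]⟩
    have := A.det_ne_zero
    rwa [Matrix.det_fin_one] at this
  · rintro ⟨a, b, ha, h⟩
    refine ⟨Matrix.GeneralLinearGroup.mkOfDetNeZero !![a] (by simpa using ha), fun _ => b, ?_⟩
    funext i
    rw [Subsingleton.elim i 0, h]
    simp [affineComp, Matrix.GeneralLinearGroup.mkOfDetNeZero]

lemma mem_orbitClass_two {f g : Fin 2 → MvPolynomial (Fin n) k} :
    g ∈ orbitClass f ↔ ∃ a b e c d e' : k, a * d - b * c ≠ 0 ∧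
      g 0 = C a * f 0 + C b * f 1 + C e ∧ g 1 = C c * f 0 + C d * f 1 + C e' := by
  constructor
  · rintro ⟨A, b, rfl⟩
    refine ⟨A.1 0 0, A.1 0 1, b 0, A.1 1 0,
      A.1 1 1, b 1, ?_, by simp [affineComp], by simp [affineComp]⟩
    have := A.det_ne_zero
    rwa [Matrix.det_fin_two] at this
  · rintro ⟨a, b, e, c, d, e', hdet, h0, h1⟩
    refine ⟨Matrix.GeneralLinearGroup.mkOfDetNeZero !![a, b; c, d]
      (by simpa [Matrix.det_fin_two] using hdet), ![e, e'], ?_⟩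
    funext i
    fin_cases i
    · simp [affineComp, Matrix.GeneralLinearGroup.mkOfDetNeZero, h0]
    · simp [affineComp, Matrix.GeneralLinearGroup.mkOfDetNeZero, h1]

end AffineOrbit

/-! ### An edge of the tree `C_2` disconnects it -/

section Tree

variable {k : Type*} [Field k]

/-! ### Leading forms and Jacobians in two variables. -/

lemma le_totalDegree_two {f : MvPolynomial (Fin 2) k} {m : Fin 2 →₀ ℕ} (h : coeff m f ≠ 0) :
    m 0 + m 1 ≤ f.totalDegree := by
  have := le_totalDegree (mem_support_iff.2 h)
  rwa [Finsupp.sum_fintype _ _ (fun _ => rfl), Fin.sum_univ_two] at this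

lemma exists_coeff_totalDegree {f : MvPolynomial (Fin 2) k} (h : f ≠ 0) :
    ∃ m, coeff m f ≠ 0 ∧ m 0 + m 1 = f.totalDegree := by
  obtain ⟨m, hm, hd⟩ := Finset.exists_mem_eq_sup f.support (by simpa using h)
    (fun s => s.sum fun _ e => e)
  refine ⟨m, mem_support_iff.1 hm, ?_⟩
  rw [totalDegree, hd, Finsupp.sum_fintype _ _ (fun _ => rfl), Fin.sum_univ_two]

lemma finsupp_two_eq {m m' : Fin 2 →₀ ℕ} : m = m' ↔ m 0 = m' 0 ∧ m 1 = m' 1 := by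
  constructor
  · rintro rfl; exact ⟨rfl, rfl⟩
  · rintro ⟨h0, h1⟩
    ext i; fin_cases i <;> assumption

/-- The polynomial is `c x_2^d + ` terms of degree less than `d`, with `d ≥ 1` and `c ≠ 0`. -/
def HasTop {k : Type*} [Field k] (f : MvPolynomial (Fin 2) k) : Prop :=
  ∃ d, 1 ≤ d ∧ coeff (Finsupp.single 1 d) f ≠ 0 ∧
    ∀ m : Fin 2 →₀ ℕ, d ≤ m 0 + m 1 → m 0 ≠ 0 ∨ m 1 ≠ d → coeff m f = 0

lemma totalDegree_pderiv_le (i : Fin 2) (f : MvPolynomial (Fin 2) k) :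
    (pderiv i f).totalDegree ≤ f.totalDegree - 1 := by
  by_cases h : pderiv i f = 0
  · simp [h]
  obtain ⟨m, hm, hd⟩ := exists_coeff_totalDegree h
  rw [coeff_pderiv] at hm
  have := le_totalDegree_two (left_ne_zero_of_mul hm)
  rw [← hd]
  fin_cases i <;> simp at this <;> omega

/-- If a top-degree monomial of `h` involved `X 0`, then `pderiv 1 f * pderiv 0 h` would have degree
`d + h.totalDegree - 2 > 0`. The other product in the Jacobian has smaller degree, so the difference
could not be constant. Characteristic zero keeps these derivatives nonzero. -/
lemma hasTop_of_jacobian [CharZero k] {f h : MvPolynomial (Fin 2) k} {d : ℕ} (hd : 1 ≤ d)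
    (hc : coeff (Finsupp.single 1 d) f ≠ 0)
    (htop : ∀ m : Fin 2 →₀ ℕ, d ≤ m 0 + m 1 → m 0 ≠ 0 ∨ m 1 ≠ d → coeff m f = 0)
    {e : k} (hJ : pderiv 0 f * pderiv 1 h - pderiv 1 f * pderiv 0 h = C e)
    (hD : 1 ≤ h.totalDegree) (hdD : 2 < d + h.totalDegree) : HasTop h := by
  have key : ∀ m : Fin 2 →₀ ℕ, m 0 + m 1 = h.totalDegree → m 0 ≠ 0 → coeff m h = 0 := by
    intro m hm h0
    by_contra hne
    have hu : coeff (Finsupp.single 1 (d - 1)) (pderiv 1 f) ≠ 0 := by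
      rw [coeff_pderiv, ← Finsupp.single_add, Nat.sub_add_cancel hd]
      refine mul_ne_zero hc ?_
      simp only [Finsupp.single_eq_same]
      norm_cast
    have hv : coeff (m - Finsupp.single 0 1) (pderiv 0 h) ≠ 0 := by
      have : m - Finsupp.single 0 1 + Finsupp.single 0 1 = m := by
        rw [finsupp_two_eq]; simp; omega
      rw [coeff_pderiv, this]
      refine mul_ne_zero hne ?_
      norm_cast
    have hu' := le_totalDegree_two hu
    have hv' := le_totalDegree_two hv
    simp at hu' hv'
    have huv := totalDegree_mul_of_isDomain (f := pderiv 1 f) (g := pderiv 0 h)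
      (by rintro h; simp [h] at hu) (by rintro h; simp [h] at hv)
    have hE : pderiv 1 f * pderiv 0 h = pderiv 0 f * pderiv 1 h - C e := by
      linear_combination -hJ
    rw [hE] at huv
    have hle := totalDegree_sub_C_le (pderiv 0 f * pderiv 1 h) e
    by_cases hz : pderiv 0 f = 0
    · rw [hz, zero_mul, totalDegree_zero] at hle
      rw [hz, zero_mul] at huv
      omega
    · obtain ⟨n, hn, hnd⟩ := exists_coeff_totalDegree hz
      -- A monomial of `pderiv 0 f` comes from a monomial of `f` divisible by `X 0`, which has
      -- degree less than `d`.
      have hlt : (pderiv 0 f).totalDegree + 1 < d := by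
        by_contra hge
        rw [coeff_pderiv, htop] at hn
        · simp at hn
        · simp; omega
        · simp
      have h1 := totalDegree_mul (pderiv 0 f) (pderiv 1 h)
      have h2 := totalDegree_pderiv_le 1 h
      omega
  have hne : h ≠ 0 := by rintro rfl; simp at hD
  obtain ⟨m, hm, hmd⟩ := exists_coeff_totalDegree hne
  have hm0 : m 0 = 0 := by
    by_contra h0; exact hm (key m hmd h0)
  have hms : m = Finsupp.single 1 h.totalDegree := by
    rw [finsupp_two_eq]; simp; omega
  refine ⟨_, hD, hms ▸ hm, fun m' h1 h2 => ?_⟩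
  by_contra h3
  have h4 := le_totalDegree_two h3
  exact h3 (key m' (by omega) (by omega))

lemma pderiv_polyAut {n : ℕ} (φ : PolyAut k n) (j : Fin n) (g : MvPolynomial (Fin n) k) :
    pderiv j (φ g) = ∑ l, φ (pderiv l g) * pderiv j (φ (X l)) := by
  induction g using MvPolynomial.induction_on with
  | C a =>
    have : φ (C a) = C a := φ.commutes a
    simp [this]
  | add p q hp hq => simp [hp, hq, add_mul, Finset.sum_add_distrib]
  | mul_X p i hp =>
    simp only [map_mul, Derivation.leibniz, smul_eq_mul, hp, map_add, add_mul,
      Finset.sum_add_distrib, Finset.mul_sum]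
    congr 1
    · rw [Finset.sum_eq_single i]
      · simp
      · intro l _ hl; simp [pderiv_X_of_ne hl.symm]
      · simp
    · exact Finset.sum_congr rfl fun l _ => by ring

/-- The Jacobian determinant of a polynomial automorphism of the plane is a constant. -/
lemma exists_jacobian_eq_C (φ : PolyAut k 2) : ∃ e : k, e ≠ 0 ∧
    pderiv 0 (φ (X 0)) * pderiv 1 (φ (X 1)) - pderiv 1 (φ (X 0)) * pderiv 0 (φ (X 1)) = C e := by
  have h : ∀ i j, ∑ l, φ (pderiv l (φ.symm (X i))) * pderiv j (φ (X l)) =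
      (1 : Matrix (Fin 2) (Fin 2) (MvPolynomial (Fin 2) k)) i j := by
    intro i j
    rw [← pderiv_polyAut, AlgEquiv.apply_symm_apply, pderiv_X, Matrix.one_apply, Pi.single_apply]
  have hu : IsUnit (pderiv 0 (φ (X 0)) * pderiv 1 (φ (X 1))
      - pderiv 1 (φ (X 0)) * pderiv 0 (φ (X 1))) := by
    have h00 := h 0 0
    have h01 := h 0 1
    have h10 := h 1 0
    have h11 := h 1 1
    simp only [Fin.sum_univ_two, Matrix.one_apply] at h00 h01 h10 h11
    simp at h00 h01 h10 h11
    refine IsUnit.of_mul_eq_one (φ (pderiv 0 (φ.symm (X 0))) * φ (pderiv 1 (φ.symm (X 1)))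
      - φ (pderiv 1 (φ.symm (X 0))) * φ (pderiv 0 (φ.symm (X 1)))) ?_
    generalize φ (pderiv 0 (φ.symm (X 0))) = a00 at *
    generalize φ (pderiv 0 (φ.symm (X 1))) = a10 at *
    generalize φ (pderiv 1 (φ.symm (X 0))) = a01 at *
    generalize φ (pderiv 1 (φ.symm (X 1))) = a11 at *
    linear_combination (a10 * pderiv 1 (φ (X 0)) + a11 * pderiv 1 (φ (X 1))) * h00 + h11
      - (a10 * pderiv 0 (φ (X 0)) + a11 * pderiv 0 (φ (X 1))) * h01
  obtain ⟨e, he, h⟩ := MvPolynomial.isUnit_iff_eq_C_of_isReduced.1 hu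
  exact ⟨e, he.ne_zero, h⟩

lemma eq_linear_of_totalDegree_le_one {h : MvPolynomial (Fin 2) k} (hd : h.totalDegree ≤ 1) :
    ∃ a b c : k, h = C a * X 0 + C b * X 1 + C c := by
  refine ⟨coeff (Finsupp.single 0 1) h, coeff (Finsupp.single 1 1) h, coeff 0 h, ?_⟩
  ext m
  simp only [coeff_add, coeff_C_mul, coeff_X, coeff_C]
  by_cases hm : m 0 + m 1 ≤ 1
  · have : m = 0 ∨ m = Finsupp.single 0 1 ∨ m = Finsupp.single 1 1 := by
      simp only [finsupp_two_eq]; simp; omega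
    rcases this with rfl | rfl | rfl <;> simp [finsupp_two_eq]
  · have h0 : coeff m h = 0 := by
      by_contra h0
      have := le_totalDegree_two h0
      omega
    have h1 : Finsupp.single 0 1 ≠ m := by rintro rfl; simp at hm
    have h2 : Finsupp.single 1 1 ≠ m := by rintro rfl; simp at hm
    have h3 : 0 ≠ m := by rintro rfl; simp at hm
    simp [h0, h1, h2, h3]


lemma HasTop.smul_add {f : MvPolynomial (Fin 2) k} (h : HasTop f) {a : k} (ha : a ≠ 0) (b : k) :
    HasTop (C a * f + C b) := by
  obtain ⟨d, hd, hc, htop⟩ := h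
  have hb : ∀ m : Fin 2 →₀ ℕ, 1 ≤ m 0 + m 1 → coeff m (C b : MvPolynomial (Fin 2) k) = 0 := by
    intro m hm
    rw [coeff_C, if_neg]
    rintro rfl; simp at hm
  refine ⟨d, hd, ?_, fun m h1 h2 => ?_⟩
  · rw [coeff_add, coeff_C_mul, hb _ (by simpa using hd), add_zero]
    exact mul_ne_zero ha hc
  · rw [coeff_add, coeff_C_mul, hb _ (by omega), htop m h1 h2, mul_zero, add_zero]

lemma hasTop_X1 : HasTop (X 1 : MvPolynomial (Fin 2) k) := by
  refine ⟨1, le_rfl, by simp, fun m h1 h2 => ?_⟩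
  rw [coeff_X, if_neg]
  rintro rfl
  simp at h2

lemma not_hasTop_X0 : ¬ HasTop (X 0 : MvPolynomial (Fin 2) k) := by
  rintro ⟨d, hd, hc, -⟩
  rw [coeff_X] at hc
  simp [finsupp_two_eq] at hc

/-- If `f_1` has leading form `c x_2^d`, then the affine combinations of `f_1` and a second
coordinate `f_2` have leading forms of the same kind, unless `f_1` and `f_2` are affine. -/
lemma hasTop_or_affine [CharZero k] (φ : PolyAut k 2) (h0 : HasTop (φ (X 0))) {a b e : k}
    (hab : a ≠ 0 ∨ b ≠ 0) : HasTop (C a * φ (X 0) + C b * φ (X 1) + C e) ∨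
      ![φ (X 0)] ∈ orbitClass ![(X 1 : MvPolynomial (Fin 2) k)] ∧
      ![φ (X 0), φ (X 1)] ∈ orbitClass ![(X 0 : MvPolynomial (Fin 2) k), X 1] := by
  by_cases hb : b = 0
  · subst hb
    left
    simpa using h0.smul_add (hab.resolve_right (by simp)) e
  obtain ⟨d, hd, hc, htop⟩ := h0
  obtain ⟨j, hj, hJ⟩ := exists_jacobian_eq_C φ
  set h := C a * φ (X 0) + C b * φ (X 1) + C e with hh
  have hJ' : pderiv 0 (φ (X 0)) * pderiv 1 h - pderiv 1 (φ (X 0)) * pderiv 0 h = C (b * j) := by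
    simp only [hh, map_add, pderiv_C_mul, pderiv_C, C_mul, ← hJ]
    ring
  have hD : 1 ≤ h.totalDegree := by
    by_contra hD
    have := (totalDegree_eq_zero_iff_eq_C (p := h)).1 (by omega)
    rw [this, pderiv_C, pderiv_C, mul_zero, mul_zero, sub_zero, eq_comm, C_eq_zero] at hJ'
    exact mul_ne_zero hb hj hJ'
  by_cases hdD : 2 < d + h.totalDegree
  · exact Or.inl (hasTop_of_jacobian hd hc htop hJ' hD hdD)
  -- Only `d = h.totalDegree = 1` is left, where the product of derivatives has degree `0` and the
  -- Jacobian argument gives nothing.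
  right
  have hd1 : d = 1 := by omega
  subst hd1
  obtain ⟨l, m, n, hlin⟩ := eq_linear_of_totalDegree_le_one (h := h) (by omega)
  obtain ⟨l', m', n', hf⟩ := eq_linear_of_totalDegree_le_one (h := φ (X 0)) (by
    by_contra hgt
    obtain ⟨q, hq, hqd⟩ := exists_coeff_totalDegree (f := φ (X 0)) (by
      rintro h0; simp [h0] at hgt)
    exact hq (htop q (by omega) (by omega)))
  have hl' : l' = 0 := by
    have := htop (Finsupp.single 0 1) (by simp) (by simp)
    rw [hf] at this
    simpa [coeff_X, coeff_C, finsupp_two_eq] using this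
  subst hl'
  have hm' : m' ≠ 0 := by
    rw [hf] at hc
    simpa [coeff_X, coeff_C, finsupp_two_eq] using hc
  have hl : l ≠ 0 := by
    rintro rfl
    rw [hlin, hf] at hJ'
    simp [hb, hj] at hJ'
  -- The second row solves `h = a f_1 + b f_2 + e` for `f_2`, with `f_1 = m' X 1 + n'` and `h = l X
  -- 0 + m X 1 + n`.
  refine ⟨mem_orbitClass_one.2 ⟨m', n', hm', by simp [hf]⟩, mem_orbitClass_two.2
    ⟨0, m', n', b⁻¹ * l, b⁻¹ * (m - a * m'), b⁻¹ * (n - a * n' - e), by simp [hm', hl, hb], ?_, ?_⟩⟩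
  · simp [hf]
  · have e1 : C b⁻¹ * C b = (1 : MvPolynomial (Fin 2) k) := by
      rw [← C_mul, inv_mul_cancel₀ hb, C_1]
    rw [hh, hf] at hlin
    simp only [Matrix.cons_val_one, Matrix.cons_val_zero, C_mul, C_sub] at hlin ⊢
    simp only [C_0, zero_mul, zero_add] at hlin
    linear_combination (-φ (X 1)) * e1 + C b⁻¹ * hlin

/-- The vertices of `C_2` on the side of `[x_2]` of the edge from `[x_2]` to `[x_1, x_2]`. -/
def OnSide {k : Type*} [Field k] (v : Vert k 2) : Prop := ∀ f ∈ v.2.1, HasTop (f 0)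

/-- From `[f_1]` to `[f_1, f_2]` this is `hasTop_or_affine`, whose exceptional case is exactly the
deleted edge. Conversely, every representative of `[f_1]` is the first coordinate of a
representative of `[f_1, f_2]`. -/
lemma onSide_of_adj [CharZero k] {e : ∀ j : Fin 2, Vertex k 2 (j + 1)}
    (he0 : (e 0).1 = orbitClass ![X 1]) (he1 : (e 1).1 = orbitClass ![X 0, X 1])
    {v w : Vert k 2} (hv : OnSide v)
    (h : ((skeleton k 2).deleteEdges {s(⟨0, e 0⟩, ⟨1, e 1⟩)}).Adj v w) : OnSide w := by
  rw [SimpleGraph.deleteEdges_adj] at h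
  obtain ⟨⟨hne, x, ⟨f, ⟨_, φ, _, hφ⟩, hx⟩, hxv, hxw⟩, hnot⟩ := h
  have hφ0 : φ (X 0) = f 0 := hφ 0
  have hφ1 : φ (X 1) = f 1 := hφ 1
  have hx0 : (x 0).1 = orbitClass ![f 0] := by
    rw [hx 0]; congr 1; funext i; fin_cases i; rfl
  have hx1 : (x 1).1 = orbitClass ![f 0, f 1] := by
    rw [hx 1]; congr 1; funext i; fin_cases i <;> rfl
  obtain ⟨i, v⟩ := v
  obtain ⟨j, w⟩ := w
  dsimp only at hne hxv hxw
  subst hxv hxw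
  have h10 : (i = 0 ∧ j = 1) ∨ (i = 1 ∧ j = 0) := by omega
  rcases h10 with ⟨rfl, rfl⟩ | ⟨rfl, rfl⟩
  · intro g hg
    change g ∈ (x 1).1 at hg
    rw [hx1] at hg
    obtain ⟨a, b, e, c, d, e', hdet, h0, -⟩ := mem_orbitClass_two.1 hg
    have hf0 : HasTop (f 0) := hv ![f 0] (by
      change _ ∈ (x 0).1
      rw [hx0]; exact mem_orbitClass_self _)
    have hab : a ≠ 0 ∨ b ≠ 0 := by
      by_contra! h
      simp [h] at hdet
    rcases hasTop_or_affine φ (hφ0 ▸ hf0) (e := e) hab with h | ⟨h1, h2⟩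
    · rw [hφ0, hφ1] at h
      exact h0 ▸ h
    · exfalso
      apply hnot
      rw [hφ0] at h1
      rw [hφ0, hφ1] at h2
      have e0 : x 0 = _ := Subtype.ext (hx0.trans ((orbitClass_eq_of_mem h1).trans he0.symm))
      have e1 : x 1 = _ := Subtype.ext (hx1.trans ((orbitClass_eq_of_mem h2).trans he1.symm))
      rw [e0, e1]; rfl
  · intro g hg
    change g ∈ (x 0).1 at hg
    rw [hx0] at hg
    obtain ⟨a, b, ha, h0⟩ := mem_orbitClass_one.1 hg
    refine hv ![g 0, f 1] ?_
    change _ ∈ (x 1).1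
    rw [hx1, mem_orbitClass_two]
    exact ⟨a, 0, b, 0, 1, 0, by simpa using ha, by simpa using h0, by simp⟩

lemma not_reachable_of_onSide [CharZero k] {e : ∀ j : Fin 2, Vertex k 2 (j + 1)}
    (he0 : (e 0).1 = orbitClass ![X 1]) (he1 : (e 1).1 = orbitClass ![X 0, X 1])
    {v : Vert k 2} (hv : OnSide v) :
    ¬ ((skeleton k 2).deleteEdges {s(⟨0, e 0⟩, ⟨1, e 1⟩)}).Reachable v ⟨1, e 1⟩ := by
  intro h
  have key : ∀ w, ((skeleton k 2).deleteEdges {s(⟨0, e 0⟩, ⟨1, e 1⟩)}).Reachable v w →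
      OnSide w := by
    intro w hw
    rw [SimpleGraph.reachable_iff_reflTransGen] at hw
    induction hw with
    | refl => exact hv
    | tail _ h ih => exact onSide_of_adj he0 he1 ih h
  refine not_hasTop_X0 (k := k) (key _ h ![X 0, X 1] ?_)
  change _ ∈ (e 1).1
  rw [he1]; exact mem_orbitClass_self _

/-- An arrow pointing away from `[x_2]` has direction `[a x_1 + b x_2]` with `a ≠ 0`. -/
lemma ne_zero_of_reachable [CharZero k] {e : ∀ j : Fin 2, Vertex k 2 (j + 1)}
    (he0 : (e 0).1 = orbitClass ![X 1]) (he1 : (e 1).1 = orbitClass ![X 0, X 1])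
    {u : Vertex k 2 1} {a b : k} (hu : u.1 = orbitClass ![C a * X 0 + C b * X 1])
    (h : ((skeleton k 2).deleteEdges {s(⟨0, e 0⟩, ⟨1, e 1⟩)}).Reachable ⟨0, u⟩ ⟨1, e 1⟩) :
    a ≠ 0 := by
  rintro rfl
  -- With `a = b = 0` the vertex would be the class of a constant, which is no component.
  have hb : b ≠ 0 := by
    rintro rfl
    obtain ⟨f, ⟨_, φ, _, hf⟩, hS⟩ := u.2
    have hf0 : φ (X 0) = f 0 := hf 0
    have hm : f ∈ orbitClass ![C (0 : k) * X 0 + C (0 : k) * (X 1 : MvPolynomial (Fin 2) k)] := by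
      rw [← hu, hS]; exact mem_orbitClass_self _
    obtain ⟨a, c, -, h0⟩ := mem_orbitClass_one.1 hm
    have h1 : φ (X 0) = φ (C c) := by
      rw [hf0, h0]
      have : φ (C c) = C c := φ.commutes c
      simp [this]
    have h2 := congrArg (coeff (Finsupp.single 0 1)) (φ.injective h1)
    simp [coeff_C, finsupp_two_eq] at h2
  refine not_reachable_of_onSide he0 he1 (v := ⟨0, u⟩) ?_ h
  intro g hg
  change g ∈ u.1 at hg
  rw [hu] at hg
  obtain ⟨c, d, hc, h0⟩ := mem_orbitClass_one.1 hg
  have := (hasTop_X1 (k := k)).smul_add (mul_ne_zero hc hb) d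
  convert this using 1
  refine h0.trans ?_
  simp [mul_assoc]

end Tree

/-! ### Triangles at `[x_3]` and arrows -/

section Triangles

variable {k : Type*} [Field k]

lemma mem_orbitClass_of_matrix {n r : ℕ} {f g : Fin r → MvPolynomial (Fin n) k}
    (M : Matrix (Fin r) (Fin r) k) (hM : M.det ≠ 0) (b : Fin r → k)
    (h : ∀ i, g i = ∑ j, C (M i j) * f j + C (b i)) : g ∈ orbitClass f :=
  ⟨Matrix.GeneralLinearGroup.mkOfDetNeZero M hM, b, funext fun i => by
    simp [h i, affineComp, Matrix.GeneralLinearGroup.mkOfDetNeZero]⟩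

lemma exists_row_of_mem_orbitClass {n : ℕ} {f g : Fin 3 → MvPolynomial (Fin n) k}
    (h : g ∈ orbitClass f) (i : Fin 3) :
    ∃ a b c e : k, g i = C a * f 0 + C b * f 1 + C c * f 2 + C e := by
  obtain ⟨A, b, rfl⟩ := h
  exact ⟨A.1 i 0, A.1 i 1, A.1 i 2, b i, by simp [affineComp, Fin.sum_univ_three]⟩

/-- Restriction to the line `p = x_3 = 0`, on which `q` is a coordinate; it serves to measure
degrees in `q`. -/
lemma CoordPair.exists_spec {p q : MvPolynomial (Fin 3) k} (h : CoordPair p q) :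
    ∃ κ : MvPolynomial (Fin 3) k →ₐ[k] Polynomial k, κ p = 0 ∧ κ q = Polynomial.X ∧
      κ (X 2) = 0 := by
  obtain ⟨φ, h0, h1, h2⟩ := h
  refine ⟨(aeval ![0, Polynomial.X, 0]).comp (φ.symm : _ →ₐ[k] _), ?_, ?_, ?_⟩
  · simp [← h0]
  · simp [← h1]
  · have : φ.symm (X 2) = X 2 := by rw [AlgEquiv.symm_apply_eq, h2]
    simp [this]

lemma natDegree_map_subst_le (κ : MvPolynomial (Fin 3) k →ₐ[k] Polynomial k)
    {q : MvPolynomial (Fin 3) k} (hq : κ q = Polynomial.X) (h2 : κ (X 2) = 0)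
    (P : Polynomial (Polynomial k)) : (κ (subst q P)).natDegree ≤ P.natDegree := by
  have : κ.toRingHom.comp (subst q) = Polynomial.mapRingHom (Polynomial.evalRingHom 0) := by
    refine Polynomial.ringHom_ext' ?_ (by simp [hq])
    refine Polynomial.ringHom_ext' ?_ (by simp [h2])
    ext a : 1
    simp
  have h3 : κ (subst q P) = P.map (Polynomial.evalRingHom 0) :=
    congrArg (fun f : Polynomial (Polynomial k) →+* _ => f P) this
  rw [h3]
  exact Polynomial.natDegree_map_le

lemma CoordPair.ne_smul_add {p q : MvPolynomial (Fin 3) k} (h : CoordPair p q) (a b : k) :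
    q ≠ C a * X 2 + C b := by
  rintro rfl
  obtain ⟨κ, -, h1, h2⟩ := h.exists_spec
  have hC : ∀ a : k, κ (C a) = Polynomial.C a := fun a => by rw [algHom_C]; rfl
  rw [map_add, map_mul, h2, mul_zero, zero_add, hC] at h1
  have := congrArg Polynomial.natDegree h1
  simp at this

lemma IsMaxSimplex.exists_components {v : ∀ r : Fin 3, Vertex k 3 (r + 1)}
    (h : IsMaxSimplex v) : ∃ φ : PolyAut k 3, (v 0).1 = orbitClass ![φ (X 0)] ∧
      (v 1).1 = orbitClass ![φ (X 0), φ (X 1)] ∧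
      (v 2).1 = orbitClass ![φ (X 0), φ (X 1), φ (X 2)] := by
  obtain ⟨f, ⟨_, φ, _, hφ⟩, hv⟩ := h
  have hφ' : ∀ i, φ (X i) = f i := hφ
  refine ⟨φ, ?_, ?_, ?_⟩
  · rw [hv 0]; congr 1; funext i; fin_cases i; exact (hφ' 0).symm
  · rw [hv 1]; congr 1; funext i; fin_cases i
    exacts [(hφ' 0).symm, (hφ' 1).symm]
  · rw [hv 2]; congr 1; funext i; fin_cases i
    exacts [(hφ' 0).symm, (hφ' 1).symm, (hφ' 2).symm]

lemma IsMaxSimplex.exists_second {v : ∀ r : Fin 3, Vertex k 3 (r + 1)}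
    (h : IsMaxSimplex v) (h0 : (v 0).1 = orbitClass ![X 2]) :
    ∃ p, (v 1).1 = orbitClass ![p, X 2] := by
  obtain ⟨φ, h0', h1, -⟩ := h.exists_components
  obtain ⟨a, b, ha, he⟩ := mem_orbitClass_one.1 (mem_of_orbitClass_eq (h0.symm.trans h0'))
  simp only [Matrix.cons_val_zero] at he
  refine ⟨φ (X 1), h1.trans (orbitClass_eq_of_mem (mem_orbitClass_two.2 ?_)).symm⟩
  exact ⟨0, 1, 0, a, 0, b, by simpa using ha, by simp, by simpa using he⟩

lemma IsMaxSimplex.exists_third {v : ∀ r : Fin 3, Vertex k 3 (r + 1)} (h : IsMaxSimplex v)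
    {p : MvPolynomial (Fin 3) k} (h1 : (v 1).1 = orbitClass ![p, X 2]) :
    ∃ p', CoordPair p' p ∧ (v 2).1 = orbitClass ![p', p, X 2] := by
  obtain ⟨φ, -, h1', h2⟩ := h.exists_components
  obtain ⟨a, b, e, c, d, e', hdet, he, he'⟩ :=
    mem_orbitClass_two.1 (mem_of_orbitClass_eq (h1.symm.trans h1'))
  simp only [Matrix.cons_val_zero, Matrix.cons_val_one] at he he'
  have hM : !![0, 0, 1; a, b, 0; c, d, 0].det ≠ 0 := by
    simpa [Matrix.det_fin_three] using hdet
  obtain ⟨θ, hθ⟩ := exists_affine_polyAut (Matrix.GeneralLinearGroup.mkOfDetNeZero _ hM)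
    ![0, e, e']
  have hC : ∀ a, φ (C a) = C a := fun a => φ.commutes a
  refine ⟨φ (X 2), ⟨φ * θ, ?_, ?_, ?_⟩, ?_⟩
  · simp [AlgEquiv.mul_apply, hθ, affineComp, Fin.sum_univ_three,
      Matrix.GeneralLinearGroup.mkOfDetNeZero]
  · simp [AlgEquiv.mul_apply, hθ, affineComp, Fin.sum_univ_three,
      Matrix.GeneralLinearGroup.mkOfDetNeZero, hC, he]
  · rw [AlgEquiv.mul_apply, hθ]
    simpa [affineComp, Fin.sum_univ_three, Matrix.GeneralLinearGroup.mkOfDetNeZero, hC]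
      using he'.symm
  · refine h2.trans (orbitClass_eq_of_mem (mem_orbitClass_of_matrix _ hM ![0, e, e'] ?_)).symm
    intro i
    fin_cases i
    · simp [Fin.sum_univ_three]
    · simpa [Fin.sum_univ_three] using he
    · simpa [Fin.sum_univ_three] using he'

/-- Two triangles at `[x_3]` with the same type `3` vertex and distinct type `2` vertices. -/
lemma IsMaxSimplex.coordPair_of_ne {v v' : ∀ r : Fin 3, Vertex k 3 (r + 1)}
    (h : IsMaxSimplex v) (h' : IsMaxSimplex v') {p p' : MvPolynomial (Fin 3) k}
    (h1 : (v 1).1 = orbitClass ![p, X 2]) (h1' : (v' 1).1 = orbitClass ![p', X 2])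
    (h2 : v 2 = v' 2) (hne : v 1 ≠ v' 1) :
    CoordPair p p' ∧ (v 2).1 = orbitClass ![p, p', X 2] := by
  obtain ⟨q, hq, hv⟩ := h.exists_third h1
  obtain ⟨q', hq', hv'⟩ := h'.exists_third h1'
  obtain ⟨a, b, c, e, he⟩ := exists_row_of_mem_orbitClass
    (mem_of_orbitClass_eq ((hv'.symm.trans (congrArg Subtype.val h2.symm)).trans hv)) 1
  simp only [Matrix.cons_val_zero, Matrix.cons_val_one, Matrix.cons_val] at he
  -- For `a = 0`, `p'` would be an affine combination of `p` and `x_3`, and the two type `2`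
  -- vertices would coincide.
  have ha : a ≠ 0 := by
    rintro rfl
    have hb : b ≠ 0 := by
      rintro rfl
      exact hq'.ne_smul_add c e (by simpa using he)
    refine hne (Subtype.ext (h1.trans ((orbitClass_eq_of_mem ?_).symm.trans h1'.symm)))
    exact mem_orbitClass_two.2 ⟨b, c, e, 0, 1, 0, by simpa using hb, by simpa using he, by simp⟩
  constructor
  · have := (hq.elementary ha (Polynomial.C (Polynomial.C b) * Polynomial.X
      + Polynomial.C (Polynomial.C c * Polynomial.X + Polynomial.C e))).symm
    convert this using 1
    rw [he]
    simp
    ring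
  · refine hv.trans (orbitClass_eq_of_mem (mem_orbitClass_of_matrix
      !![0, 1, 0; a, b, c; 0, 0, 1] (by simpa [Matrix.det_fin_three] using ha) ![0, e, 0]
      fun i => ?_)).symm
    fin_cases i
    · simp [Fin.sum_univ_three]
    · simpa [Fin.sum_univ_three] using he
    · simp [Fin.sum_univ_three]

/-- The leading form becomes `c` times the `d`-th power of a linear polynomial of slope `a β ≠ 0`;
terms of total degree less than `d` keep degree less than `d` under a substitution of degree at most
`1`. -/
lemma natDegree_aeval_of_top {P : MvPolynomial (Fin 2) k} {a b c : k} {d : ℕ} (hc : c ≠ 0)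
    (ha : a ≠ 0) (htop : (P - C c * (C a * X 0 + C b * X 1) ^ d).totalDegree < d)
    {β δ μ : k} (hβ : β ≠ 0) :
    (aeval ![Polynomial.C β * Polynomial.X + Polynomial.C δ, Polynomial.C μ] P).natDegree
      = d := by
  set G := P - C c * (C a * X 0 + C b * X 1) ^ d with hG
  set u : Fin 2 → Polynomial k := ![Polynomial.C β * Polynomial.X + Polynomial.C δ,
    Polynomial.C μ] with hu
  have hC : ∀ x : k, aeval u (C x : MvPolynomial (Fin 2) k) = Polynomial.C x := fun x => by
    rw [algHom_C]; rfl
  have h1 : (aeval u G).natDegree < d := by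
    refine lt_of_le_of_lt (aeval_natDegree_le G le_rfl u (n := 1) fun i => ?_) (by simpa using htop)
    fin_cases i
    · exact Polynomial.natDegree_linear_le
    · simp [hu]
  have h2 : (aeval u (C c * (C a * X 0 + C b * X 1) ^ d)).natDegree = d := by
    simp only [map_mul, map_pow, map_add, hC, aeval_X]
    have : Polynomial.C a * u 0 + Polynomial.C b * u 1 =
        Polynomial.C (a * β) * Polynomial.X + Polynomial.C (a * δ + b * μ) := by
      simp [hu]; ring
    rw [this, Polynomial.natDegree_C_mul hc, Polynomial.natDegree_pow,
      Polynomial.natDegree_linear (mul_ne_zero ha hβ), mul_one]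
  have h3 : P = G + C c * (C a * X 0 + C b * X 1) ^ d := by rw [hG]; ring
  rw [h3, map_add, Polynomial.natDegree_add_eq_right_of_natDegree_lt (by rw [h2]; exact h1), h2]

/-- An arrow pointing away from `[x_3]` is not linear over `k[x_3]`. -/
lemma one_lt_natDegree_of_arrowTowards [CharZero k] {v1 : Vertex k 3 1} {v2 : Vertex k 3 2}
    {v3 v3' : Vertex k 3 3} {p p' q : MvPolynomial (Fin 3) k} (h1 : v1.1 = orbitClass ![X 2])
    (h2 : v2.1 = orbitClass ![q, X 2]) (h3 : v3.1 = orbitClass ![p, q, X 2])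
    (h3' : v3'.1 = orbitClass ![p', q, X 2]) (hpq : CoordPair p q) {α : k}
    {P : Polynomial (Polynomial k)} (hP : p' = C α * p + subst q P)
    (harrow : ArrowTowards 1 v1 v2 v3 v3') : 1 < P.natDegree := by
  obtain ⟨φ, -, P₀, ⟨g1, g2, g3, g3'⟩, u, e, ⟨-, a, b, c, d, hd, hc, hu, htop⟩, he0, he1, hr⟩ :=
    harrow
  have ha : a ≠ 0 := ne_zero_of_reachable he0 he1 hu hr
  obtain ⟨κ, hp, hq, hz⟩ := hpq.exists_spec
  have hC : ∀ x : k, κ (C x) = Polynomial.C x := fun x => by rw [algHom_C]; rfl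
  obtain ⟨l, μ, -, hX2⟩ := mem_orbitClass_one.1 (mem_of_orbitClass_eq (g1.symm.trans h1))
  obtain ⟨β, γ, δ, -, -, -, -, hX1, -⟩ :=
    mem_orbitClass_two.1 (mem_of_orbitClass_eq (g2.symm.trans h2))
  obtain ⟨s, t, w, -, -, -, -, hqX, -⟩ :=
    mem_orbitClass_two.1 (mem_of_orbitClass_eq (h2.symm.trans g2))
  obtain ⟨b0, b1, b2, b3, hX0⟩ :=
    exists_row_of_mem_orbitClass (mem_of_orbitClass_eq (g3.symm.trans h3)) 0
  obtain ⟨c0, c1, c2, c3, hX0'⟩ :=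
    exists_row_of_mem_orbitClass (mem_of_orbitClass_eq (g3'.symm.trans h3')) 0
  simp only [Matrix.cons_val_zero, Matrix.cons_val_one, Matrix.cons_val] at hX2 hX1 hqX hX0 hX0'
  have hβ : β ≠ 0 := by
    rintro rfl
    refine hpq.ne_smul_add (s * γ + t * l) (s * δ + t * μ + w) (hqX.trans ?_)
    rw [hX1, hX2]
    simp only [C_0, zero_mul, zero_add, C_add, C_mul]
    ring
  have k0 : κ (φ (X 0)) = Polynomial.C b1 * Polynomial.X + Polynomial.C b3 := by
    rw [hX0]; simp [hp, hq, hz, hC]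
  have k1 : κ (φ (X 1)) = Polynomial.C β * Polynomial.X + Polynomial.C δ := by
    rw [hX1]; simp [hq, hz, hC]
  have k2 : κ (φ (X 2)) = Polynomial.C μ := by
    rw [hX2]; simp [hz, hC]
  have kP : κ (φ (aeval ![X 1, X 2] P₀)) = aeval ![Polynomial.C β * Polynomial.X + Polynomial.C δ,
      Polynomial.C μ] P₀ := by
    have : (κ.comp ((φ : MvPolynomial (Fin 3) k →ₐ[k] MvPolynomial (Fin 3) k).comp (aeval ![X 1, X 2]))) =
        aeval ![Polynomial.C β * Polynomial.X + Polynomial.C δ, Polynomial.C μ] := by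
      ext i : 1
      fin_cases i
      · simp [k1]
      · simp [k2]
    exact congrArg (fun f : MvPolynomial (Fin 2) k →ₐ[k] Polynomial k => f P₀) this
  have hdeg := natDegree_aeval_of_top hc ha htop (δ := δ) (μ := μ) hβ
  have hE := congrArg κ hX0'
  rw [map_add φ, map_add κ, kP, k0] at hE
  have hrhs : κ (C c0 * p' + C c1 * q + C c2 * X 2 + C c3) =
      Polynomial.C c0 * κ (subst q P) + (Polynomial.C c1 * Polynomial.X + Polynomial.C c3) := by
    rw [hP]; simp [hp, hq, hz, hC, add_assoc]
  rw [hrhs] at hE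
  -- In `hE` the left side has degree `d ≥ 2`, while the right side has degree at most `1` if `P` is
  -- linear.
  by_contra hlt
  have hS := natDegree_map_subst_le κ hq hz P
  have hL : (Polynomial.C c0 * κ (subst q P) + (Polynomial.C c1 * Polynomial.X
      + Polynomial.C c3)).natDegree ≤ 1 :=
    Polynomial.natDegree_add_le_of_degree_le
      ((Polynomial.natDegree_C_mul_le _ _).trans (by omega)) Polynomial.natDegree_linear_le
  rw [← hE, Polynomial.natDegree_add_eq_right_of_natDegree_lt, hdeg] at hL
  · omega
  · rw [hdeg]
    exact lt_of_le_of_lt Polynomial.natDegree_linear_le (by omega)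

/-! ### The vertices of the axis -/

@[simp] lemma hAut_X0 : hAut k (X 0) = X 2 := by simp [hAut]
@[simp] lemma hAut_X2 : hAut k (X 2) = X 1 := by simp [hAut]

lemma fAut_X0 (n : ℕ) : (fAut k n : PolyAut k 3) (X 0) = X 2 := by
  simp only [fAut, Subgroup.coe_mul, Subgroup.coe_pow, AlgEquiv.mul_apply, hAut_X0]
  exact gAut_pow_X2 n

lemma fAut_X2 (n : ℕ) : (fAut k n : PolyAut k 3) (X 2) = axisComponent k (n + 1) := by
  simp only [fAut, Subgroup.coe_mul, Subgroup.coe_pow, AlgEquiv.mul_apply, hAut_X2]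
  exact gAut_pow_X1 n

lemma act_mkVertex {n r : ℕ} [NeZero n] (g : Tame k n) (f : Fin r → MvPolynomial (Fin n) k)
    (hf : IsComponents f) : ((mkVertex f hf).act g).1 =
      orbitClass fun i => (g : PolyAut k n) (f i) := by
  ext p
  constructor
  · rintro ⟨_, ⟨A, b, rfl⟩, rfl⟩
    exact ⟨A, b, map_affineComp _ A b f⟩
  · rintro ⟨A, b, rfl⟩
    exact ⟨_, ⟨A, b, rfl⟩, map_affineComp _ A b f⟩

lemma orbitClass_swap {n : ℕ} (p q : MvPolynomial (Fin n) k) :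
    orbitClass ![p, q] = orbitClass ![q, p] :=
  orbitClass_eq_of_mem (mem_orbitClass_two.2 ⟨0, 1, 0, 1, 0, 0, by simp, by simp, by simp⟩)

lemma axis_one {n : ℕ} {v : Vertex k 3 2} (h : (⟨1, v⟩ : Vert k 3) = axis k n 1) :
    v.1 = orbitClass ![X 0, X 2] := by
  rw [axis, if_neg (by decide)] at h
  rw [eq_of_heq (Sigma.mk.inj h).2]
  have := act_mkVertex (fAut k n ^ ((1 : ℤ) / 2)) _ (isComponents_x1_x3 k)
  refine this.trans ?_
  congr 1

lemma axis_two {n : ℕ} {v : Vertex k 3 1} (h : (⟨0, v⟩ : Vert k 3) = axis k n 2) :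
    v.1 = orbitClass ![X 2] := by
  rw [axis, if_pos (by decide)] at h
  rw [eq_of_heq (Sigma.mk.inj h).2]
  have := act_mkVertex (fAut k n ^ ((2 : ℤ) / 2)) _ (isComponents_x1 k)
  refine this.trans ?_
  congr 1
  funext i
  fin_cases i
  norm_num [fAut_X0]

lemma axis_three {n : ℕ} {v : Vertex k 3 2} (h : (⟨1, v⟩ : Vert k 3) = axis k n 3) :
    v.1 = orbitClass ![axisComponent k (n + 1), X 2] := by
  rw [axis, if_neg (by decide)] at h
  rw [eq_of_heq (Sigma.mk.inj h).2, orbitClass_swap]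
  have := act_mkVertex (fAut k n ^ ((3 : ℤ) / 2)) _ (isComponents_x1_x3 k)
  refine this.trans ?_
  congr 1
  funext i
  fin_cases i <;> norm_num [fAut_X0, fAut_X2]

end Triangles

/-! ### The star of a boundary vertex -/

/-- The triangles around a boundary vertex `v` form a strip `u 0, s (u 0), r (s (u 0)), …`,
where `s` and `r` are the reflections in the two kinds of edges at `v`. -/
lemma exists_strip {F : Type} [Finite F] {s r : F → F} (hs : Function.Involutive s)
    (hr : Function.Involutive r) {S : Set F} {a b : F} (ha : r a = a) (hb : r b = b)
    (hab : a ≠ b) (haS : a ∈ S) (hbS : b ∈ S) (hsS : ∀ x ∈ S, s x ∈ S) (hrS : ∀ x ∈ S, r x ∈ S)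
    (hmin : ∀ T : Set F, a ∈ T → (∀ x ∈ T, s x ∈ T ∧ r x ∈ T) → S ⊆ T) :
    ∃ (m : ℕ) (u : ℕ → F), 1 ≤ m ∧ u 0 = a ∧ u m = b ∧ Set.InjOn u (Set.Iio (2 * m)) ∧
      S = u '' Set.Iio (2 * m) ∧ (∀ j ≤ 2 * m, r (u j) = u (2 * m - j)) ∧
      ∀ j < 2 * m, s (u j) = u (2 * m - 1 - j) := by
  -- `τ` advances by two triangles. Since `r` fixes `a`, the `τ`-orbit of `a` is stable under both
  -- reflections. In the order of the strip the triangles are `u 0, u (2m-1), u 1, u (2m-2), …, u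
  -- (m-1), u m`.
  set τ : F → F := fun x => r (s x) with hτ
  have hinj : Function.Injective τ := hr.injective.comp hs.injective
  set M := Function.minimalPeriod τ a
  have hM : 0 < M := Function.minimalPeriod_pos_of_mem_periodicPts (hinj.mem_periodicPts a)
  have hback : ∀ j, τ^[j] (r (τ^[j] a)) = a := by
    intro j
    induction j with
    | zero => exact ha
    | succ j ih =>
      have : τ (r (τ (τ^[j] a))) = r (τ^[j] a) := by
        simp only [hτ, hr _, hs _]
      rw [Function.iterate_succ_apply, Function.iterate_succ_apply', this, ih]
  have hru : ∀ j ≤ M, r (τ^[j] a) = τ^[M - j] a := by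
    intro j hj
    apply hinj.iterate j
    rw [hback, ← Function.iterate_add_apply, Nat.add_sub_cancel' hj]
    exact (Function.iterate_minimalPeriod).symm
  have hsu : ∀ j < M, s (τ^[j] a) = τ^[M - 1 - j] a := by
    intro j hj
    have : s (τ^[j] a) = r (τ^[j + 1] a) := by
      rw [Function.iterate_succ_apply']; simp only [hτ, hr _]
    rw [this, hru _ hj, Nat.sub_sub, Nat.add_comm 1 j]
  have hS : S = (fun j => τ^[j] a) '' Set.Iio M := by
    apply Set.Subset.antisymm
    · refine hmin _ ⟨0, hM, rfl⟩ ?_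
      rintro _ ⟨j, hj, rfl⟩
      rw [Set.mem_Iio] at hj
      refine ⟨⟨M - 1 - j, by rw [Set.mem_Iio]; omega, (hsu j hj).symm⟩, ?_⟩
      rcases Nat.eq_zero_or_pos j with rfl | h0
      · exact ⟨0, hM, ha.symm⟩
      · exact ⟨M - j, by rw [Set.mem_Iio]; omega, (hru j hj.le).symm⟩
    · rintro _ ⟨j, -, rfl⟩
      show τ^[j] a ∈ S
      induction j with
      | zero => exact haS
      | succ j ih => rw [Function.iterate_succ_apply']; exact hrS _ (hsS _ ih)
  have hI := Function.iterate_injOn_Iio_minimalPeriod (f := τ) (x := a)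
  obtain ⟨j, hj, rfl⟩ : b ∈ (fun j => τ^[j] a) '' Set.Iio M := hS ▸ hbS
  rw [Set.mem_Iio] at hj
  have hj0 : j ≠ 0 := by rintro rfl; exact hab rfl
  have h2 := hru j hj.le
  rw [hb] at h2
  -- The reflection `r` sends position `j` to `M - j`, so its fixed triangle `b` sits halfway round
  -- the orbit.
  have h3 : j = M - j := hI hj (by show M - j < M; omega) h2
  have h4 : 2 * j = M := by omega
  exact ⟨j, fun j => τ^[j] a, by omega, rfl, rfl, by rwa [h4], by rwa [h4], by rwa [h4],
    by rwa [h4]⟩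

/-! ### The strip at a type `1` boundary vertex of a diagram. -/

namespace DiscDiagram

variable {k : Type*} [Field k] (D : DiscDiagram k)

lemma vert_zero_of_mem_star {a t : D.Face} (h : t ∈ D.star 0 a) : D.vert 0 t = D.vert 0 a := by
  induction h with
  | refl => rfl
  | tail _ h ih =>
    obtain ⟨j, hj, rfl⟩ := h
    rw [D.vert_glue 0 j _ hj, ih]

lemma exists_strip {a b : D.Face} (ha : D.IsBoundaryEdge 2 a) (hb : D.IsBoundaryEdge 2 b)
    (hab : b ∈ D.star 0 a) (hne : a ≠ b) :
    ∃ (m : ℕ) (u : ℕ → D.Face), 1 ≤ m ∧ u 0 = a ∧ u m = b ∧ Set.InjOn u (Set.Iio (2 * m)) ∧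
      D.star 0 a = u '' Set.Iio (2 * m) ∧ (∀ j ≤ 2 * m, D.σ 2 (u j) = u (2 * m - j)) ∧
      ∀ j < 2 * m, D.σ 1 (u j) = u (2 * m - 1 - j) := by
  have := D.finite_face
  refine _root_.exists_strip (D.involutive 1) (D.involutive 2) ha hb hne
    Relation.ReflTransGen.refl hab (fun x hx => hx.tail ⟨1, by decide, rfl⟩)
    (fun x hx => hx.tail ⟨2, by decide, rfl⟩) ?_
  intro T haT hT x hx
  induction hx with
  | refl => exact haT
  | tail _ h ih =>
    obtain ⟨j, hj, rfl⟩ := h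
    fin_cases j
    · exact absurd rfl hj
    · exact (hT _ ih).1
    · exact (hT _ ih).2

/-- The edges of type `(1,3)` are the pairs `u j, u (2m-1-j)` with `j < m`; those of type `(1,2)`
are the pairs `u j, u (2m-j)` with `j ≤ m`, which degenerate to single triangles at the boundary
edges `j = 0` and `j = m`. -/
lemma le_valence {a : D.Face} {m : ℕ} {u : ℕ → D.Face} (hm : 1 ≤ m)
    (hu : Set.InjOn u (Set.Iio (2 * m))) (hS : D.star 0 a = u '' Set.Iio (2 * m))
    (h2 : ∀ j ≤ 2 * m, D.σ 2 (u j) = u (2 * m - j))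
    (h1 : ∀ j < 2 * m, D.σ 1 (u j) = u (2 * m - 1 - j)) (h0 : D.σ 2 (u 0) = u 0) :
    2 * m + 1 ≤ D.valence 0 a := by
  have := D.finite_face
  have hinj : ∀ i < 2 * m, ∀ j < 2 * m, u i = u j → i = j := fun i hi j hj h => hu hi hj h
  have e1 : m ≤ (D.edge 1 '' D.star 0 a).ncard := by
    have hI : Set.InjOn (fun j => D.edge 1 (u j)) (Set.Iio m) := by
      intro i hi j hj hij
      rw [Set.mem_Iio] at hi hj
      have h : u i ∈ D.edge 1 (u j) := by
        change D.edge 1 (u i) = D.edge 1 (u j) at hij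
        rw [← hij]; exact Set.mem_insert _ _
      rcases h with h | h
      · exact hinj i (by omega) j (by omega) h
      · rw [Set.mem_singleton_iff, h1 j (by omega)] at h
        have := hinj i (by omega) _ (by omega) h
        omega
    calc m = ((fun j => D.edge 1 (u j)) '' Set.Iio m).ncard := by
          rw [hI.ncard_image, ← Finset.coe_Iio, Set.ncard_coe_finset, Nat.card_Iio]
      _ ≤ _ := Set.ncard_le_ncard (by
          rintro _ ⟨j, hj, rfl⟩
          rw [Set.mem_Iio] at hj
          exact ⟨u j, hS ▸ ⟨j, by rw [Set.mem_Iio]; omega, rfl⟩, rfl⟩) (Set.toFinite _)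
  have e2 : m + 1 ≤ (D.edge 2 '' D.star 0 a).ncard := by
    have hI : Set.InjOn (fun j => D.edge 2 (u j)) (Set.Iio (m + 1)) := by
      intro i hi j hj hij
      rw [Set.mem_Iio] at hi hj
      have h : u i ∈ D.edge 2 (u j) := by
        change D.edge 2 (u i) = D.edge 2 (u j) at hij
        rw [← hij]; exact Set.mem_insert _ _
      rcases h with h | h
      · exact hinj i (by omega) j (by omega) h
      · rw [Set.mem_singleton_iff] at h
        rcases Nat.eq_zero_or_pos j with rfl | hj0
        · rw [h0] at h
          exact hinj i (by omega) 0 (by omega) h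
        · rw [h2 j (by omega)] at h
          have := hinj i (by omega) _ (by omega) h
          omega
    calc m + 1 = ((fun j => D.edge 2 (u j)) '' Set.Iio (m + 1)).ncard := by
          rw [hI.ncard_image, ← Finset.coe_Iio, Set.ncard_coe_finset, Nat.card_Iio]
      _ ≤ _ := Set.ncard_le_ncard (by
          rintro _ ⟨j, hj, rfl⟩
          rw [Set.mem_Iio] at hj
          exact ⟨u j, hS ▸ ⟨j, by rw [Set.mem_Iio]; omega, rfl⟩, rfl⟩) (Set.toFinite _)
  have e : D.valence 0 a = (D.edge 1 '' D.star 0 a).ncard + (D.edge 2 '' D.star 0 a).ncard := by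
    rw [valence, show Finset.univ.erase (0 : Fin 3) = {1, 2} by decide,
      Finset.sum_pair (by decide)]
  omega

end DiscDiagram

/-! ### The curvature bound. -/

lemma orbitClass_swap_three {k : Type*} [Field k] {n : ℕ} (p q z : MvPolynomial (Fin n) k) :
    orbitClass ![p, q, z] = orbitClass ![q, p, z] :=
  orbitClass_eq_of_mem (mem_orbitClass_of_matrix !![0, 1, 0; 1, 0, 0; 0, 0, 1]
    (by simp [Matrix.det_fin_three]) 0 fun i => by fin_cases i <;> simp [Fin.sum_univ_three])

/-- The sides opposite to the type `3` corners of the triangles `a` and `b` are boundary edges of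
`D` with a common vertex of type `1`; together they form a subpath of the boundary of `D` that
maps to `γ(1), γ(2), γ(3)`. -/
theorem mainTheorem8 {k : Type*} [Field k] [CharZero k] (n : ℕ)
    (D : DiscDiagram k) (hD : D.IsReduced) (a b : D.Face)
    (ha : D.IsBoundaryEdge 2 a) (hb : D.IsBoundaryEdge 2 b) (hab : b ∈ D.star 0 a)
    (h1 : D.image 1 a = axis k n 1) (h2 : D.image 0 a = axis k n 2)
    (h3 : D.image 1 b = axis k n 3) :
    D.boundaryCurvature a ≤ (2 - (n : ℚ)) / 6 := by
  have v1 := axis_one h1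
  have v0 := axis_two h2
  have v3 := axis_three h3
  -- Elements of the span of `x_1, x_3, 1` specialize to degree `0` in `Y`, but `g^{n+1} · x_1` to
  -- degree `1`; so `γ(1) ≠ γ(3)`.
  have hne : a ≠ b := by
    rintro rfl
    have h := v1.symm.trans v3
    obtain ⟨c, d, e, -, -, -, -, hX, -⟩ := mem_orbitClass_two.1 (mem_of_orbitClass_eq h.symm)
    simp only [Matrix.cons_val_zero, Matrix.cons_val_one] at hX
    have hlex := (spec_axisComponent (k := k) n).1
    rw [hX] at hlex
    have := congrArg (fun x => (ofLex x).1) hlex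
    have hsp : spec (C c * X 0 + C d * X 2 + C e : MvPolynomial (Fin 3) k) =
        Polynomial.C (Polynomial.C d * Polynomial.X + Polynomial.C e) := by simp
    rw [hsp] at this
    simp only [lexDegree, ofLex_toLex, Polynomial.natDegree_C] at this
    omega
  obtain ⟨m, u, hm, rfl, rfl, hinj, hS, hσ2, hσ1⟩ := D.exists_strip ha hb hab hne
  have hval := D.le_valence hm hinj hS hσ2 hσ1 ha
  have hu0 : ∀ j < 2 * m, (D.vert 0 (u j)).1 = orbitClass ![X 2] := fun j hj => by
    rw [D.vert_zero_of_mem_star (a := u 0) (by rw [hS]; exact ⟨j, hj, rfl⟩)]; exact v0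
  have hex : ∀ j, ∃ p, (j = 0 → p = X 0) ∧ (j = m → p = axisComponent k (n + 1)) ∧
      (j ≤ m → (D.vert 1 (u j)).1 = orbitClass ![p, X 2]) := by
    intro j
    by_cases hj0 : j = 0
    · subst hj0
      exact ⟨X 0, fun _ => rfl, fun h => by omega, fun _ => v1⟩
    by_cases hjm : j = m
    · subst hjm
      exact ⟨_, fun h => absurd h hj0, fun _ => rfl, fun _ => v3⟩
    by_cases hj : j ≤ m
    · obtain ⟨p, hp⟩ := (D.isTriangle (u j)).exists_second (hu0 j (by omega))
      exact ⟨p, fun h => absurd h hj0, fun h => absurd h hjm, fun _ => hp⟩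
    · exact ⟨0, fun h => absurd h hj0, fun h => absurd h hjm, fun h => absurd h hj⟩
  choose p hp0 hpm hp using hex
  -- The triangles `u j` and `σ 1 (u j)` share their type `3` vertex; reducedness at their common
  -- edge makes the type `2` vertices `[p_j, x_3]` and `[p_{j+1}, x_3]` distinct.
  have hpair : ∀ j < m, CoordPair (p j) (p (j + 1)) ∧
      (D.vert 2 (u j)).1 = orbitClass ![p j, p (j + 1), X 2] := by
    intro j hj
    have hs := hσ1 j (by omega)
    have hne : u j ≠ D.σ 1 (u j) := by
      rw [hs]
      intro h
      have := hinj (by rw [Set.mem_Iio]; omega) (by rw [Set.mem_Iio]; omega) h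
      omega
    have hv : D.vert 1 (D.σ 1 (u j)) = D.vert 1 (u (j + 1)) := by
      rw [← D.vert_glue 1 2 (D.σ 1 (u j)) (by decide), hs, hσ2 _ (by omega)]
      congr 2; omega
    refine (D.isTriangle (u j)).coordPair_of_ne (D.isTriangle (D.σ 1 (u j))) (hp j hj.le)
      (hv ▸ hp (j + 1) hj) (D.vert_glue 2 1 (u j) (by decide)).symm ?_
    exact (hD.edges 1 (u j) hne.symm).symm
  have hturn : ∀ j, ∃ (α : k) (P : Polynomial (Polynomial k)), α ≠ 0 ∧
      (j + 1 < m → p (j + 2) = C α * p j + subst (p (j + 1)) P) := by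
    intro j
    by_cases hj : j + 1 < m
    · obtain ⟨α, hα, P, hP⟩ :=
        (hpair j (by omega)).1.eq_elementary (hpair (j + 1) hj).1.symm
      exact ⟨α, P, hα, fun _ => hP⟩
    · exact ⟨1, 0, one_ne_zero, fun h => absurd h hj⟩
  choose α P hα hP using hturn
  have hn := le_card_linear_turns p α P (hp0 0 rfl) hm (fun j hj => (hpair j hj).1) hα hP
    (hpm m rfl)
  have hback : ∀ j, j + 1 < m → D.vert 2 (u (2 * m - (j + 1))) = D.vert 2 (u j) := by
    intro j hj
    rw [← D.vert_glue 2 1 (u j) (by decide), hσ1 j (by omega)]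
    congr 2; omega
  -- The interior edge between `u (j + 1)` and `u (2m - (j + 1))` is matched with the turn of index
  -- `j`.
  have harr : D.arrows 1 (u 0) ≤
      ((Finset.range (m - 1)).filter fun j => ¬ (P j).natDegree ≤ 1).card := by
    refine le_trans (Set.ncard_le_ncard (t := (fun j => D.edge 2 (u (j + 1))) ''
      ((Finset.range (m - 1)).filter fun j => ¬ (P j).natDegree ≤ 1 : Finset ℕ)) ?_
      (Set.toFinite _)) ((Set.ncard_image_le (Set.toFinite _)).trans
        (Set.ncard_coe_finset _).le)
    rintro _ ⟨x, ⟨hx, hbd, harrow⟩, rfl⟩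
    rw [hS] at hx
    obtain ⟨i, hi, rfl⟩ := hx
    rw [Set.mem_Iio] at hi
    have hi0 : i ≠ 0 := by rintro rfl; exact hbd ha
    have him : i ≠ m := by rintro rfl; exact hbd hb
    rw [hσ2 i hi.le] at harrow
    have e0 := hu0 i hi
    -- The edge may be represented by either of its triangles. From `u (j + 1)` the turn is read
    -- backwards, with polynomial `-α⁻¹ P`; from the other side it is read as it stands.
    rcases lt_or_gt_of_ne him with hlt | hgt
    · obtain ⟨j, rfl⟩ := Nat.exists_eq_succ_of_ne_zero hi0
      refine ⟨j, ?_, rfl⟩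
      simp only [Finset.coe_filter, Finset.mem_range, Set.mem_ofPred_eq]
      refine ⟨by omega, ?_⟩
      rw [Nat.succ_eq_add_one, hback j hlt] at harrow
      obtain ⟨hq, hT⟩ := hpair j (by omega)
      obtain ⟨hq', hT'⟩ := hpair (j + 1) hlt
      have hc : C (α j)⁻¹ * C (α j) = (1 : MvPolynomial (Fin 3) k) := C_inv_mul (hα j)
      have := one_lt_natDegree_of_arrowTowards e0 (hp (j + 1) hlt.le)
        (hT'.trans (orbitClass_swap_three _ _ _)) hT hq'.symm (α := (α j)⁻¹)
        (P := Polynomial.C (Polynomial.C (-(α j)⁻¹)) * P j)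
        (by
          simp only [map_mul, subst_C_C, C_neg]
          linear_combination C (α j)⁻¹ * (- hP j hlt) - p j * hc) harrow
      have := this.trans_le (Polynomial.natDegree_C_mul_le _ _)
      omega
    · obtain ⟨j, hj⟩ : ∃ j, i = 2 * m - (j + 1) := ⟨2 * m - i - 1, by omega⟩
      have hjm : j + 1 < m := by omega
      have hi' : 2 * m - i = j + 1 := by omega
      have hedge : D.edge 2 (u (j + 1)) = D.edge 2 (u i) := by
        rw [DiscDiagram.edge, DiscDiagram.edge, hσ2 i hi.le, hσ2 (j + 1) (by omega), hi', ← hj,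
          Set.pair_comm]
      refine ⟨j, ?_, hedge⟩
      simp only [Finset.coe_filter, Finset.mem_range, Set.mem_ofPred_eq]
      refine ⟨by omega, ?_⟩
      have hv1 : D.vert 1 (u i) = D.vert 1 (u (j + 1)) := by
        rw [← D.vert_glue 1 2 (u i) (by decide), hσ2 i hi.le, hi']
      obtain ⟨hq, hT⟩ := hpair j (by omega)
      obtain ⟨hq', hT'⟩ := hpair (j + 1) hjm
      rw [hi', hv1, hj, hback j hjm] at harrow
      rw [hj] at e0
      have := one_lt_natDegree_of_arrowTowards e0 (hp (j + 1) hjm.le)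
        hT (hT'.trans (orbitClass_swap_three _ _ _)) hq (hP j hjm) harrow
      omega
  have hcard := Finset.card_filter_add_card_filter_not (s := Finset.range (m - 1))
    (fun j => (P j).natDegree ≤ 1)
  rw [Finset.card_range] at hcard
  have hfin : D.arrows 1 (u 0) + n + 1 ≤ m := by omega
  rw [DiscDiagram.boundaryCurvature]
  have q1 : (2 * m + 1 : ℚ) ≤ D.valence 0 (u 0) := by exact_mod_cast hval
  have q2 : (D.arrows 1 (u 0) + n + 1 : ℚ) ≤ m := by exact_mod_cast hfin
  have q3 : (0 : ℚ) ≤ D.arrows 0 (u 0) := Nat.cast_nonneg _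
  linarith
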